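/- Let $k$ be a perfect field of characteristic $p>0$. Let $\mathfrak g$ and $\mathfrak h$ be finite-dimensional abelian restricted Lie algebras over $k$ (the $p$-map is written $x\mapsto x^p$), with $\dim\mathfrak g=1$. Let $z$ be a generator of $\mathfrak g$, and let $\lambda\in k$ be the scalar with $z^p+\lambda z=0$. Let $\rho:\mathfrak g\to\operatorname{End}_k(\mathfrak h)$ be an algebraic representation, that is, a $k$-linear map such that for all $x,y\in\mathfrak g$ and $a\in\mathfrak h$ we have $\rho_x\rho_y=\rho_y\rho_x$, $\rho_{x^p}=(\rho_x)^p$ and $\rho_x(a^p)=0$. Write $T=(\mathfrak g,\mathfrak h,\rho)$. Let $A=u(\mathfrak h)$ be the restricted universal enveloping algebra (the elements of $\mathfrak h$ being primitive), with augmentation ideal $A^+$, and extend $\rho_z$ to the derivation of $A$ that equals $\rho_z$ on $\mathfrak h$. Put $\overline\Delta(a)=\Delta(a)-a\otimes1-1\otimes a$, $d^1=-\overline\Delta:A^+\to A^+\otimes A^+$ and $d^2=-\overline\Delta\otimes1+1\otimes\overline\Delta$ on $A^+\otimes A^+$, and let $\mathrm Z^2=\operatorname{Ker}d^2$, $\mathrm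 B^2=\operatorname{Im}d^1$ and $\mathrm H^2(\Omega A)=\mathrm Z^2/\mathrm B^2$. On $\mathfrak h$, on $A^+$ and on $A^+\otimes A^+$ define $$\Phi_z(x)=x^p+\lambda x+\rho_z^{\,p-1}(x),$$ where $\rho_z$ acts on $A^+\otimes A^+$ as $\rho_z\otimes1+1\otimes\rho_z$; then $\Phi_z$ induces a map on $\mathrm H^2(\Omega A)$. Let $\mathcal E^2$ be the set of all pairs $(\Theta,\chi)\in A^+\times\mathrm Z^2$ with $\rho_z(\Theta)=0$ and $\Phi_z(\chi)=d^1(\Theta)$. Write $(\Theta',\chi')\sim(\Theta,\chi)$ if there is $a\in A^+$ with $\Theta'-\Theta=\Phi_z(a)$ and $\chi'-\chi=d^1(a)$. Let $\mathcal H^2(T)$ be the set of all classes in $\mathcal E^2/{\sim}$ that contain no pair $(\Theta,\chi)$ with $\chi\in\mathrm B^2$. A class $\xi\in\mathrm H^2(\Omega A)$ is called $z$-characteristic if $\Phi_z(\xi)=0$; it is called admissible if it is represented by a cocycle $\chi$ for which there is $a\in A^+$ with $\Phi_z(\chi)=d^1(a)$ and $\rho_z(a)=0$. Every admissible class is $z$-characteristic,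 and $q:[(\Theta,\chi)]\mapsto[\chi]$ maps $\mathcal H^2(T)$ into the set of nonzero admissible classes. Let $\operatorname{Aut}(T)$ be the group of all pairs $\sigma=(\alpha,\beta)$ of automorphisms of the restricted Lie algebras $\mathfrak g$ and $\mathfrak h$ with $\rho_x(\beta(y))=\beta(\rho_{\alpha(x)}(y))$ for all $x\in\mathfrak g$, $y\in\mathfrak h$. Let $\gamma_\sigma\in k^\times$ be given by $\alpha(z)=\gamma_\sigma z$, and write $\sigma$ also for the automorphism of $A$ induced by $\beta$. Then $\operatorname{Aut}(T)$ acts on $\mathcal H^2(T)$ by $\sigma.[(\Theta,\chi)]=[(\gamma_\sigma^p\sigma(\Theta),\gamma_\sigma(\sigma\otimes\sigma)(\chi))]$ and on $\mathrm H^2(\Omega A)$ by $\sigma.[\chi]=[\gamma_\sigma(\sigma\otimes\sigma)(\chi)]$. The second action preserves the sets of nonzero admissible and of nonzero $z$-characteristic classes, and $q$ is equivariant. **Proposition.** Suppose that $\{x\in\mathfrak h:\rho_z(x)=0\}=\{\Phi_z(x):x\in\mathfrak h\}$. Then $q$ induces a bijection between the $\operatorname{Aut}(T)$-orbits in $\mathcal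 H^2(T)$ and the $\operatorname{Aut}(T)$-orbits of nonzero admissible classes in $\mathrm H^2(\Omega A)$. If moreover $\mathfrak h$ or $\mathfrak g$ is a torus (every element $x$ of it generates a semisimple subalgebra of its restricted universal enveloping algebra), then $q$ induces a bijection between the $\operatorname{Aut}(T)$-orbits in $\mathcal H^2(T)$ and the $\operatorname{Aut}(T)$-orbits of all nonzero $z$-characteristic classes in $\mathrm H^2(\Omega A)$. -/

import Mathlib

open scoped TensorProduct

noncomputable section

/-! ## The cobar construction in low degrees

`A` is a commutative bialgebra over a field.  The degree-`n` part `(A⁺)^{⊗ n}` of the cobar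
construction `Ω A = T(A⁺)` is regarded as a subspace of `A^{⊗ n}` (tensoring over a field is
exact).  Only the degrees `1, 2, 3` are needed for `H²(Ω A)`. -/

namespace Cobar

variable (k : Type*) {A : Type*} [Field k] [CommRing A] [Bialgebra k A]

variable (A) in
/-- The augmentation ideal `A⁺ = ker ε`. -/
def augIdeal : Submodule k A := LinearMap.ker (Coalgebra.counit : A →ₗ[k] k)

/-- `a ↦ a ⊗ 1`. -/
def inL : A →ₗ[k] A ⊗[k] A := (TensorProduct.mk k A A).flip 1

/-- `a ↦ 1 ⊗ a`. -/
def inR : A →ₗ[k] A ⊗[k] A := TensorProduct.mk k A A 1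

/-- The reduced comultiplication `a ↦ Δ a - a ⊗ 1 - 1 ⊗ a`. -/
def redComul : A →ₗ[k] A ⊗[k] A := Coalgebra.comul - inL k - inR k

/-- The differential `d¹ = -Δ̄`. -/
def d1 : A →ₗ[k] A ⊗[k] A := -redComul k

/-- The differential `d² = -(Δ̄ ⊗ 1) + 1 ⊗ Δ̄`. -/
def d2 : A ⊗[k] A →ₗ[k] A ⊗[k] (A ⊗[k] A) :=
  -((TensorProduct.assoc k A A A).toLinearMap ∘ₗ (redComul k).rTensor A) + (redComul k).lTensor A

variable (A) in
/-- `A⁺ ⊗ A⁺`, as a subspace of `A ⊗ A`. -/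
def cochains2 : Submodule k (A ⊗[k] A) :=
  LinearMap.range (TensorProduct.map (augIdeal k A).subtype (augIdeal k A).subtype)

variable (A) in
/-- The `2`-cocycles `Z²(Ω A)`. -/
def Z2 : Submodule k (A ⊗[k] A) := cochains2 k A ⊓ LinearMap.ker (d2 k)

variable (A) in
/-- The `2`-coboundaries `B²(Ω A)`. -/
def B2 : Submodule k (A ⊗[k] A) := (augIdeal k A).map (d1 k)

variable (A) in
/-- The second cohomology `H²(Ω A) = Z² / B²`. -/
abbrev H2 : Type _ := Z2 k A ⧸ (B2 k A).submoduleOf (Z2 k A)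

variable {k}

/-- The cohomology class of a `2`-cocycle. -/
def cls (χ : Z2 k A) : H2 k A := Submodule.Quotient.mk χ

theorem cls_eq {χ χ' : Z2 k A} : cls χ = cls χ' ↔ (χ - χ' : A ⊗[k] A) ∈ B2 k A := by
  unfold cls
  rw [Submodule.Quotient.eq]
  simp [Submodule.submoduleOf]

/-! ### The `z`-operator -/

/-- The operator `x ↦ x ^ p + λ x + δ ^ (p - 1) x` on a commutative algebra with a linear
endomorphism `δ`.  On `(A⁺)^{⊗ n}`, with `δ` the diagonal action of `z`, this is the `z`-operator
`Φ_z = 𝒫 + ρ_z ^ (p - 1) + λ` for a generator `z` with `z ^ p + λ z = 0`. -/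
def zOp (p : ℕ) (lam : k) {R : Type*} [CommRing R] [Algebra k R] (δ : R →ₗ[k] R) (x : R) : R :=
  x ^ p + lam • x + (δ ^ (p - 1)) x

/-- The diagonal action `δ ⊗ 1 + 1 ⊗ δ` of a primitive element on `A ⊗ A`. -/
def diag2 (δ : A →ₗ[k] A) : A ⊗[k] A →ₗ[k] A ⊗[k] A := δ.rTensor A + δ.lTensor A

/-- The diagonal action on `A ⊗ A ⊗ A`. -/
def diag3 (δ : A →ₗ[k] A) : A ⊗[k] (A ⊗[k] A) →ₗ[k] A ⊗[k] (A ⊗[k] A) :=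
  δ.rTensor (A ⊗[k] A) + (diag2 δ).lTensor A

/-- Compatibility of `δ` with unit, comultiplication and counit, as holds for the action of a
primitive element on a module Hopf algebra. -/
structure Compat (δ : A →ₗ[k] A) : Prop where
  map_one : δ 1 = 0
  comul : Coalgebra.comul ∘ₗ δ = diag2 δ ∘ₗ Coalgebra.comul
  counit : Coalgebra.counit ∘ₗ δ = 0

theorem zOp_algHom {p : ℕ} {lam : k} {R S : Type*} [CommRing R] [Algebra k R] [CommRing S]
    [Algebra k S] (f : R →ₐ[k] S) {δ : R →ₗ[k] R} {δ' : S →ₗ[k] S}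
    (h : δ' ∘ₗ f.toLinearMap = f.toLinearMap ∘ₗ δ) (x : R) :
    f (zOp p lam δ x) = zOp p lam δ' (f x) := by
  have := LinearMap.congr_fun (Module.End.commute_pow_left_of_commute h (p - 1)) x
  simp only [LinearMap.comp_apply, AlgHom.toLinearMap_apply] at this
  simp [zOp, this]

/-- Behaviour of the `z`-operator under an algebra map which rescales `δ` by `γ`. -/
theorem zOp_twist {p : ℕ} [hp : Fact p.Prime] {lam γ : k} {R : Type*} [CommRing R] [Algebra k R]
    (f : R →ₐ[k] R) {δ : R →ₗ[k] R} (hlam : γ ^ p * lam = γ * lam)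
    (h : ∀ x, δ (f x) = γ • f (δ x)) (x : R) :
    zOp p lam δ (γ • f x) = γ ^ p • f (zOp p lam δ x) := by
  have hn : ∀ n : ℕ, ∀ x, (δ ^ n) (f x) = γ ^ n • f ((δ ^ n) x) := by
    intro n
    induction n with
    | zero => intro x; simp
    | succ n ih =>
      intro x
      rw [pow_succ, Module.End.mul_apply, h, map_smul, ih, smul_smul, Module.End.mul_apply,
        pow_succ' γ]
  have hg : γ * γ ^ (p - 1) = γ ^ p := mul_pow_sub_one hp.out.ne_zero γ
  simp only [zOp, map_add, map_pow, map_smul, smul_pow, smul_add, hn, smul_smul, hg]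
  rw [hlam, mul_comm lam γ]

section charP

variable (k) in
theorem add_pow_p (p : ℕ) [Fact p.Prime] [CharP k p] {R : Type*} [CommRing R] [Algebra k R]
    (x y : R) : (x + y) ^ p = x ^ p + y ^ p := by
  rcases subsingleton_or_nontrivial R with h | h
  · exact Subsingleton.elim _ _
  · have : CharP R p := charP_of_injective_algebraMap (algebraMap k R).injective p
    exact add_pow_char ..

variable (k) in
theorem sub_pow_p (p : ℕ) [Fact p.Prime] [CharP k p] {R : Type*} [CommRing R] [Algebra k R]
    (x y : R) : (x - y) ^ p = x ^ p - y ^ p := by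
  have := add_pow_p k p (x - y) y
  rw [sub_add_cancel] at this
  rw [this]; ring

variable {p : ℕ} [Fact p.Prime] [CharP k p] {lam : k}

theorem zOp_sub {R : Type*} [CommRing R] [Algebra k R] (δ : R →ₗ[k] R) (x y : R) :
    zOp p lam δ (x - y) = zOp p lam δ x - zOp p lam δ y := by
  simp only [zOp, sub_pow_p k p, smul_sub, map_sub]; ring

theorem zOp_add {R : Type*} [CommRing R] [Algebra k R] (δ : R →ₗ[k] R) (x y : R) :
    zOp p lam δ (x + y) = zOp p lam δ x + zOp p lam δ y := by
  simp only [zOp, add_pow_p k p, smul_add, map_add]; ring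

end charP

/-! ### The `z`-operator on cohomology -/

theorem diag2_mem {δ : A →ₗ[k] A} (hδ : Compat δ) {x : A ⊗[k] A} (hx : x ∈ cochains2 k A) :
    diag2 δ x ∈ cochains2 k A := by
  have hm : ∀ a ∈ augIdeal k A, δ a ∈ augIdeal k A := fun a _ => LinearMap.congr_fun hδ.counit a
  obtain ⟨y, rfl⟩ := hx
  induction y with
  | zero => simp
  | add a b ha hb => rw [map_add, map_add]; exact add_mem ha hb
  | tmul a b =>
    refine ⟨⟨δ a, hm a a.2⟩ ⊗ₜ b + a ⊗ₜ ⟨δ b, hm b b.2⟩, ?_⟩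
    simp [diag2]

theorem augIdeal_mul {a b : A} (ha : a ∈ augIdeal k A) : a * b ∈ augIdeal k A := by
  have : Coalgebra.counit (R := k) a = 0 := ha
  simp [augIdeal, Bialgebra.counit_mul, this]

theorem cochains2_mul {x y : A ⊗[k] A} (hx : x ∈ cochains2 k A) (hy : y ∈ cochains2 k A) :
    x * y ∈ cochains2 k A := by
  obtain ⟨x, rfl⟩ := hx
  obtain ⟨y, rfl⟩ := hy
  induction x with
  | zero => simp
  | add a b ha hb => rw [map_add, add_mul]; exact add_mem ha hb
  | tmul a b =>
    induction y with
    | zero => simp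
    | add c d hc hd => rw [map_add, mul_add]; exact add_mem hc hd
    | tmul c d =>
      exact ⟨⟨a * c, augIdeal_mul a.2⟩ ⊗ₜ ⟨b * d, augIdeal_mul b.2⟩, by simp⟩

theorem cochains2_pow {x : A ⊗[k] A} (hx : x ∈ cochains2 k A) {n : ℕ} (hn : n ≠ 0) :
    x ^ n ∈ cochains2 k A := by
  obtain ⟨n, rfl⟩ := Nat.exists_eq_succ_of_ne_zero hn
  clear hn
  induction n with
  | zero => simpa using hx
  | succ n ih => rw [pow_succ]; exact cochains2_mul ih hx

theorem pow_mem_of_stable {R : Type*} [AddCommGroup R] [Module k R] {δ : R →ₗ[k] R}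
    {S : Submodule k R} (h : ∀ x ∈ S, δ x ∈ S) (n : ℕ) {x : R} (hx : x ∈ S) :
    (δ ^ n) x ∈ S := by
  induction n generalizing x with
  | zero => simpa using hx
  | succ n ih => rw [pow_succ, Module.End.mul_apply]; exact ih (h x hx)

variable (k A) in
/-- `x ↦ 1 ⊗ x` on `A ⊗ A`, with values in `A ⊗ (A ⊗ A)`. -/
def face0 : A ⊗[k] A →ₐ[k] A ⊗[k] (A ⊗[k] A) := Algebra.TensorProduct.includeRight

variable (k A) in
/-- `Δ ⊗ 1` on `A ⊗ A`. -/
def face1 : A ⊗[k] A →ₐ[k] A ⊗[k] (A ⊗[k] A) :=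
  (Algebra.TensorProduct.assoc k k k A A A).toAlgHom.comp
    (Algebra.TensorProduct.map (Bialgebra.comulAlgHom k A) (AlgHom.id k A))

variable (k A) in
/-- `1 ⊗ Δ` on `A ⊗ A`. -/
def face2 : A ⊗[k] A →ₐ[k] A ⊗[k] (A ⊗[k] A) :=
  Algebra.TensorProduct.map (AlgHom.id k A) (Bialgebra.comulAlgHom k A)

variable (k A) in
/-- `x ↦ x ⊗ 1` on `A ⊗ A`, with values in `A ⊗ (A ⊗ A)`. -/
def face3 : A ⊗[k] A →ₐ[k] A ⊗[k] (A ⊗[k] A) :=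
  Algebra.TensorProduct.map (AlgHom.id k A) Algebra.TensorProduct.includeLeft

theorem d1_apply (a : A) :
    d1 k a = Algebra.TensorProduct.includeLeft (R := k) (S := k) (A := A) (B := A) a
      + Algebra.TensorProduct.includeRight (R := k) (A := A) (B := A) a
      - Bialgebra.comulAlgHom k A a := by
  simp [d1, redComul, inL, inR]
  abel

theorem d2_apply (x : A ⊗[k] A) :
    d2 k x = face0 k A x - face1 k A x + face2 k A x - face3 k A x := by
  induction x with
  | zero => simp
  | add a b ha hb => simp only [map_add, ha, hb]; abel
  | tmul a b =>
    have h : (Algebra.TensorProduct.assoc k k k A A A) (Coalgebra.comul (R := k) a ⊗ₜ[k] b)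
        = (TensorProduct.assoc k A A A) (Coalgebra.comul (R := k) a ⊗ₜ[k] b) := rfl
    simp [d2, redComul, inL, inR, face0, face1, face2, face3, TensorProduct.sub_tmul,
      TensorProduct.tmul_sub, h]
    abel

theorem face_diag {δ : A →ₗ[k] A} (hδ : Compat δ) :
    diag3 δ ∘ₗ (face0 k A).toLinearMap = (face0 k A).toLinearMap ∘ₗ diag2 δ ∧
    diag3 δ ∘ₗ (face1 k A).toLinearMap = (face1 k A).toLinearMap ∘ₗ diag2 δ ∧
    diag3 δ ∘ₗ (face2 k A).toLinearMap = (face2 k A).toLinearMap ∘ₗ diag2 δ ∧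
    diag3 δ ∘ₗ (face3 k A).toLinearMap = (face3 k A).toLinearMap ∘ₗ diag2 δ := by
  have hc : ∀ a, Coalgebra.comul (R := k) (δ a) = diag2 δ (Coalgebra.comul (R := k) a) :=
    fun a => LinearMap.congr_fun hδ.comul a
  refine ⟨?_, ?_, ?_, ?_⟩
  · ext a b
    simp [face0, diag3, diag2, hδ.map_one, TensorProduct.tmul_add]
  · ext a b
    simp only [face1, TensorProduct.AlgebraTensorModule.curry_apply, LinearMap.restrictScalars_self,
      TensorProduct.curry_apply, LinearMap.comp_apply, AlgHom.toLinearMap_apply, AlgHom.comp_apply,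
      Algebra.TensorProduct.map_tmul, diag2, LinearMap.add_apply, LinearMap.rTensor_tmul,
      LinearMap.lTensor_tmul, map_add, Bialgebra.comulAlgHom_apply, AlgHom.id_apply, hc]
    generalize Coalgebra.comul (R := k) a = y
    induction y with
    | zero => simp
    | add u v hu hv =>
      simp only [TensorProduct.add_tmul, map_add] at hu hv ⊢
      rw [hu, hv]; abel
    | tmul u v =>
      simp [diag3, diag2, TensorProduct.add_tmul, TensorProduct.tmul_add]
      abel
  · ext a b
    simp [face2, diag3, hc]
    simp [diag2, hc]
  · ext a b
    simp [face3, diag3, diag2, hδ.map_one]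

section charP

variable {p : ℕ} [Fact p.Prime] [CharP k p] {lam : k}

theorem zOp_d1 {δ : A →ₗ[k] A} (hδ : Compat δ) (a : A) :
    d1 k (zOp p lam δ a) = zOp p lam (diag2 δ) (d1 k a) := by
  rw [d1_apply, d1_apply, zOp_sub, zOp_add, zOp_algHom (δ' := diag2 δ), zOp_algHom (δ' := diag2 δ),
    zOp_algHom (δ' := diag2 δ)]
  · exact hδ.comul.symm
  · ext a; simp [diag2, hδ.map_one]
  · ext a; simp [diag2, hδ.map_one]

theorem zOp_d2 {δ : A →ₗ[k] A} (hδ : Compat δ) (x : A ⊗[k] A) :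
    d2 k (zOp p lam (diag2 δ) x) = zOp p lam (diag3 δ) (d2 k x) := by
  obtain ⟨h0, h1, h2, h3⟩ := face_diag hδ
  rw [d2_apply, d2_apply, zOp_sub, zOp_add, zOp_sub, zOp_algHom _ h0, zOp_algHom _ h1,
    zOp_algHom _ h2, zOp_algHom _ h3]

theorem zOp_mem_augIdeal {δ : A →ₗ[k] A} (hδ : Compat δ) {a : A} (ha : a ∈ augIdeal k A) :
    zOp p lam δ a ∈ augIdeal k A := by
  have h0 : Coalgebra.counit (R := k) a = 0 := ha
  refine add_mem (add_mem ?_ (Submodule.smul_mem _ _ ha)) (pow_mem_of_stable (fun x _ => ?_) _ ha)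
  · simp [augIdeal, Bialgebra.counit_pow, h0, (Fact.out : p.Prime).ne_zero]
  · exact LinearMap.congr_fun hδ.counit x

theorem zOp_mem_Z2 {δ : A →ₗ[k] A} (hδ : Compat δ) {x : A ⊗[k] A} (hx : x ∈ Z2 k A) :
    zOp p lam (diag2 δ) x ∈ Z2 k A := by
  refine ⟨?_, ?_⟩
  · exact add_mem (add_mem (cochains2_pow hx.1 (Fact.out : p.Prime).ne_zero)
      (Submodule.smul_mem _ _ hx.1)) (pow_mem_of_stable (fun x h => diag2_mem hδ h) _ hx.1)
  · have h0 : d2 k x = 0 := hx.2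
    change d2 k _ = 0
    rw [zOp_d2 hδ, h0]
    simp [zOp, (Fact.out : p.Prime).ne_zero]

theorem zOp_mem_B2 {δ : A →ₗ[k] A} (hδ : Compat δ) {x : A ⊗[k] A} (hx : x ∈ B2 k A) :
    zOp p lam (diag2 δ) x ∈ B2 k A := by
  obtain ⟨a, ha, rfl⟩ := hx
  exact ⟨zOp p lam δ a, zOp_mem_augIdeal hδ ha, zOp_d1 hδ a⟩

variable (p lam) in
/-- The `z`-operator on `2`-cocycles. -/
def zOpZ2 {δ : A →ₗ[k] A} (hδ : Compat δ) (χ : Z2 k A) : Z2 k A :=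
  ⟨zOp p lam (diag2 δ) χ, zOp_mem_Z2 hδ χ.2⟩

variable (p lam) in
/-- The `z`-operator induced on `H²(Ω A)`. -/
def zOpH2 {δ : A →ₗ[k] A} (hδ : Compat δ) : H2 k A → H2 k A :=
  Quotient.map' (zOpZ2 p lam hδ) (by
    intro χ χ' h
    rw [Submodule.quotientRel_def] at h ⊢
    have h' : (χ - χ' : A ⊗[k] A) ∈ B2 k A := h
    have := zOp_mem_B2 (p := p) (lam := lam) hδ h'
    rw [zOp_sub] at this
    exact this)

end charP

/-! ### Functoriality -/

/-- Compatibility of an algebra endomorphism with the coalgebra structure. -/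
structure IsBialgMap (f : A →ₐ[k] A) : Prop where
  comul : (Algebra.TensorProduct.map f f).comp (Bialgebra.comulAlgHom k A)
    = (Bialgebra.comulAlgHom k A).comp f
  counit : (Bialgebra.counitAlgHom k A).comp f = Bialgebra.counitAlgHom k A

/-- `f ⊗ f`. -/
abbrev map2 (f : A →ₐ[k] A) : A ⊗[k] A →ₐ[k] A ⊗[k] A := Algebra.TensorProduct.map f f

theorem IsBialgMap.mem_augIdeal {f : A →ₐ[k] A} (hf : IsBialgMap f) {a : A}
    (ha : a ∈ augIdeal k A) : f a ∈ augIdeal k A := by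
  have h0 : Coalgebra.counit (R := k) a = 0 := ha
  have := AlgHom.congr_fun hf.counit a
  simpa [augIdeal, h0] using this

theorem IsBialgMap.d1_map {f : A →ₐ[k] A} (hf : IsBialgMap f) (a : A) :
    map2 f (d1 k a) = d1 k (f a) := by
  have := AlgHom.congr_fun hf.comul a
  simp only [AlgHom.comp_apply] at this
  rw [d1_apply, d1_apply, map_sub, map_add, ← this]
  simp

theorem IsBialgMap.d2_map {f : A →ₐ[k] A} (hf : IsBialgMap f) (x : A ⊗[k] A) :
    d2 k (map2 f x) = Algebra.TensorProduct.map f (map2 f) (d2 k x) := by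
  have hc : ∀ a, Coalgebra.comul (R := k) (f a) = map2 f (Coalgebra.comul (R := k) a) :=
    fun a => (AlgHom.congr_fun hf.comul a).symm
  have h1 : (face1 k A).comp (map2 f) =
      (Algebra.TensorProduct.map f (map2 f)).comp (face1 k A) := by
    apply Algebra.TensorProduct.ext
    · apply AlgHom.ext
      intro a
      simp only [face1, AlgHom.comp_apply, Algebra.TensorProduct.includeLeft_apply,
        Algebra.TensorProduct.map_tmul, map_one, Bialgebra.comulAlgHom_apply, hc]
      generalize Coalgebra.comul (R := k) a = y
      induction y with
      | zero => simp
      | add u v hu hv => simp only [TensorProduct.add_tmul, map_add, hu, hv]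
      | tmul u v => simp
    · apply AlgHom.ext
      intro a
      simp [face1, Algebra.TensorProduct.one_def]
  have h2 : (face2 k A).comp (map2 f) =
      (Algebra.TensorProduct.map f (map2 f)).comp (face2 k A) := by
    ext a
    · simp [face2]
    · simp [face2, hc]
  have h1' := AlgHom.congr_fun h1 x
  have h2' := AlgHom.congr_fun h2 x
  have h0' : face0 k A (map2 f x) = Algebra.TensorProduct.map f (map2 f) (face0 k A x) := by
    simp [face0]
  have h3' : face3 k A (map2 f x) = Algebra.TensorProduct.map f (map2 f) (face3 k A x) := by
    induction x with
    | zero => simp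
    | add u v hu hv =>
      simp only [map_add]
      rw [hu (AlgHom.congr_fun h1 u) (AlgHom.congr_fun h2 u) (by simp [face0]),
        hv (AlgHom.congr_fun h1 v) (AlgHom.congr_fun h2 v) (by simp [face0])]
    | tmul u v => simp [face3]
  simp only [AlgHom.comp_apply] at h1' h2'
  simp only [d2_apply, map_add, map_sub, h0', h1', h2', h3']

theorem IsBialgMap.mem_Z2 {f : A →ₐ[k] A} (hf : IsBialgMap f) {x : A ⊗[k] A}
    (hx : x ∈ Z2 k A) : map2 f x ∈ Z2 k A := by
  refine ⟨?_, ?_⟩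
  · obtain ⟨y, rfl⟩ := hx.1
    clear hx
    induction y with
    | zero => simp
    | add a b ha hb => rw [map_add, map_add]; exact add_mem ha hb
    | tmul a b =>
      exact ⟨⟨f a, hf.mem_augIdeal a.2⟩ ⊗ₜ ⟨f b, hf.mem_augIdeal b.2⟩, by simp⟩
  · have h0 : d2 k x = 0 := hx.2
    change d2 k _ = 0
    rw [hf.d2_map, h0, map_zero]

theorem IsBialgMap.mem_B2 {f : A →ₐ[k] A} (hf : IsBialgMap f) {x : A ⊗[k] A}
    (hx : x ∈ B2 k A) : map2 f x ∈ B2 k A := by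
  obtain ⟨a, ha, rfl⟩ := hx
  exact ⟨f a, hf.mem_augIdeal ha, (hf.d1_map a).symm⟩

/-- `χ ↦ γ (f ⊗ f)(χ)` on `2`-cocycles. -/
def actZ2 (γ : k) {f : A →ₐ[k] A} (hf : IsBialgMap f) : Z2 k A →ₗ[k] Z2 k A :=
  γ • (map2 f).toLinearMap.restrict (fun _ hx => hf.mem_Z2 hx)

/-- The map induced by `χ ↦ γ (f ⊗ f)(χ)` on `H²(Ω A)`. -/
def actH2 (γ : k) {f : A →ₐ[k] A} (hf : IsBialgMap f) : H2 k A →ₗ[k] H2 k A :=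
  Submodule.mapQ _ _ (actZ2 γ hf) (fun _ hx => Submodule.smul_mem _ γ (hf.mem_B2 hx))

theorem diag2_twist {f : A →ₐ[k] A} {γ : k} {δ : A →ₗ[k] A}
    (h : ∀ x, δ (f x) = γ • f (δ x)) (x : A ⊗[k] A) :
    diag2 δ (map2 f x) = γ • map2 f (diag2 δ x) := by
  induction x with
  | zero => simp
  | add a b ha hb => simp only [map_add, ha, hb, smul_add]
  | tmul a b => simp [diag2, h, TensorProduct.smul_tmul']

end Cobar

/-! ## Abelian restricted Lie algebras and their restricted enveloping algebras -/

/-- An abelian restricted Lie algebra over a field `k` of characteristic `p`.  As the bracket is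
zero, it is a `k`-vector space with a `p`-map `x ↦ x^[p]` that is additive and `p`-semilinear
(Jacobson's correction terms and the condition `ad (x^[p]) = (ad x)^p` are trivial). -/
class AbRestrictedLie (p : ℕ) (k L : Type*) [Field k] [AddCommGroup L] [Module k L] where
  /-- The `p`-map. -/
  pMap : L → L
  pMap_add : ∀ x y, pMap (x + y) = pMap x + pMap y
  pMap_smul : ∀ (c : k) x, pMap (c • x) = c ^ p • pMap x

/-- The `p`-map `x ↦ x^[p]`. -/
def ppow (p : ℕ) (k : Type*) {L : Type*} [Field k] [AddCommGroup L] [Module k L]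
    [AbRestrictedLie p k L] (x : L) : L :=
  AbRestrictedLie.pMap p k x

section RestrEnv

variable (p : ℕ) (k L : Type*) [Field k] [AddCommGroup L] [Module k L] [AbRestrictedLie p k L]

/-- The ideal generated by all `x ^ p - x^[p]` in the enveloping algebra of the abelian Lie algebra
`L`, which is the symmetric algebra of `L`. -/
def restrIdeal : Ideal (SymmetricAlgebra k L) :=
  Ideal.span (Set.range fun x : L =>
    SymmetricAlgebra.ι k L x ^ p - SymmetricAlgebra.ι k L (ppow p k x))

/-- The restricted universal enveloping algebra `u(L)` of an abelian restricted Lie algebra. -/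
def RestrEnv : Type _ := SymmetricAlgebra k L ⧸ restrIdeal p k L

namespace RestrEnv

instance : CommRing (RestrEnv p k L) :=
  inferInstanceAs (CommRing (SymmetricAlgebra k L ⧸ restrIdeal p k L))

instance : Algebra k (RestrEnv p k L) :=
  inferInstanceAs (Algebra k (SymmetricAlgebra k L ⧸ restrIdeal p k L))

/-- The quotient map from the enveloping algebra. -/
def proj : SymmetricAlgebra k L →ₐ[k] RestrEnv p k L :=
  Ideal.Quotient.mkₐ k (restrIdeal p k L)

/-- The canonical map `L → u(L)`. -/
def ι : L →ₗ[k] RestrEnv p k L := (proj p k L).toLinearMap ∘ₗ SymmetricAlgebra.ι k L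

variable {p k L}

theorem ι_pow (x : L) : ι p k L x ^ p = ι p k L (ppow p k x) := by
  have h : SymmetricAlgebra.ι k L x ^ p - SymmetricAlgebra.ι k L (ppow p k x)
      ∈ restrIdeal p k L := Ideal.subset_span ⟨x, rfl⟩
  have h2 : proj p k L (SymmetricAlgebra.ι k L x ^ p - SymmetricAlgebra.ι k L (ppow p k x)) = 0 :=
    Ideal.Quotient.eq_zero_iff_mem.mpr h
  rw [map_sub, map_pow, sub_eq_zero] at h2
  exact h2

/-- The universal property of `u(L)`. -/
def lift {R : Type*} [CommRing R] [Algebra k R] (f : L →ₗ[k] R)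
    (hf : ∀ x, f x ^ p = f (ppow p k x)) : RestrEnv p k L →ₐ[k] R :=
  Ideal.Quotient.liftₐ (restrIdeal p k L) (SymmetricAlgebra.lift f) (by
    intro a ha
    have hle : restrIdeal p k L ≤ RingHom.ker (SymmetricAlgebra.lift f) := by
      refine Ideal.span_le.mpr ?_
      rintro _ ⟨x, rfl⟩
      simp [RingHom.mem_ker, hf]
    exact hle ha)

@[simp]
theorem lift_ι {R : Type*} [CommRing R] [Algebra k R] (f : L →ₗ[k] R)
    (hf : ∀ x, f x ^ p = f (ppow p k x)) (x : L) : lift f hf (ι p k L x) = f x :=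
  SymmetricAlgebra.lift_ι_apply f x

theorem hom_ext {R : Type*} [CommRing R] [Algebra k R] {F G : RestrEnv p k L →ₐ[k] R}
    (h : ∀ x, F (ι p k L x) = G (ι p k L x)) : F = G := by
  have h2 : F.comp (proj p k L) = G.comp (proj p k L) :=
    SymmetricAlgebra.algHom_ext (LinearMap.ext h)
  apply AlgHom.ext
  intro a
  obtain ⟨b, rfl⟩ := Ideal.Quotient.mk_surjective a
  exact AlgHom.congr_fun h2 b

variable [Fact p.Prime] [CharP k p]

variable (p k L) in
/-- `x ↦ x ⊗ 1 + 1 ⊗ x` on `L`. -/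
def primMap : L →ₗ[k] RestrEnv p k L ⊗[k] RestrEnv p k L :=
  ((TensorProduct.mk k _ _).flip 1 + TensorProduct.mk k _ _ 1) ∘ₗ ι p k L

theorem primMap_apply (x : L) :
    primMap p k L x = ι p k L x ⊗ₜ[k] 1 + 1 ⊗ₜ[k] ι p k L x := rfl

theorem primMap_pow (x : L) : primMap p k L x ^ p = primMap p k L (ppow p k x) := by
  rw [primMap_apply, primMap_apply, Cobar.add_pow_p k p, Algebra.TensorProduct.tmul_pow,
    Algebra.TensorProduct.tmul_pow, one_pow, ι_pow]

/-- The comultiplication of `u(L)`: elements of `L` are primitive. -/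
def comulHom : RestrEnv p k L →ₐ[k] RestrEnv p k L ⊗[k] RestrEnv p k L :=
  lift (primMap p k L) primMap_pow

theorem comulHom_ι (x : L) :
    comulHom (ι p k L x) = ι p k L x ⊗ₜ[k] 1 + 1 ⊗ₜ[k] ι p k L x := by
  rw [comulHom, lift_ι, primMap_apply]

/-- The counit of `u(L)`. -/
def counitHom : RestrEnv p k L →ₐ[k] k :=
  lift 0 (by intro x; simp [(Fact.out : p.Prime).ne_zero])

theorem counitHom_ι (x : L) : counitHom (ι p k L x) = 0 := by
  rw [counitHom, lift_ι]; rfl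

instance : Bialgebra k (RestrEnv p k L) :=
  .ofAlgHom comulHom counitHom
    (by
      apply hom_ext
      intro x
      simp [comulHom_ι, Algebra.TensorProduct.one_def, TensorProduct.add_tmul,
        TensorProduct.tmul_add]
      abel)
    (by apply hom_ext; intro x; simp [comulHom_ι, counitHom_ι])
    (by apply hom_ext; intro x; simp [comulHom_ι, counitHom_ι])

theorem comul_ι (x : L) :
    Coalgebra.comul (R := k) (ι p k L x) = ι p k L x ⊗ₜ[k] 1 + 1 ⊗ₜ[k] ι p k L x :=
  comulHom_ι x

theorem counit_ι (x : L) : Coalgebra.counit (R := k) (ι p k L x) = 0 :=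
  counitHom_ι x

/-- The algebra map `a ↦ a + ε δ(a)` to the dual numbers over `u(L)` which extends a linear
endomorphism `r` of `L` that kills all `x^[p]`. -/
def dualHom (r : L →ₗ[k] L) (hr : ∀ x, r (ppow p k x) = 0) :
    RestrEnv p k L →ₐ[k] TrivSqZeroExt (RestrEnv p k L) (RestrEnv p k L) :=
  lift ((TrivSqZeroExt.inlAlgHom k (RestrEnv p k L) (RestrEnv p k L)).toLinearMap ∘ₗ ι p k L
      + (TrivSqZeroExt.inrHom (RestrEnv p k L) (RestrEnv p k L)).restrictScalars k
        ∘ₗ ι p k L ∘ₗ r) (by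
    intro x
    have h2 : (TrivSqZeroExt.inr (ι p k L (r x)) :
        TrivSqZeroExt (RestrEnv p k L) (RestrEnv p k L)) ^ p = 0 :=
      pow_eq_zero_of_le (Fact.out : p.Prime).two_le (by
        rw [pow_two, TrivSqZeroExt.inr_mul_inr])
    change (TrivSqZeroExt.inl (ι p k L x) + TrivSqZeroExt.inr (ι p k L (r x)) :
        TrivSqZeroExt (RestrEnv p k L) (RestrEnv p k L)) ^ p
      = TrivSqZeroExt.inl (ι p k L (ppow p k x)) + TrivSqZeroExt.inr (ι p k L (r (ppow p k x)))
    rw [Cobar.add_pow_p k p, h2, hr, ← ι_pow, TrivSqZeroExt.inl_pow, map_zero,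
      TrivSqZeroExt.inr_zero])

theorem fst_dualHom (r : L →ₗ[k] L) (hr : ∀ x, r (ppow p k x) = 0) (a : RestrEnv p k L) :
    (dualHom r hr a).fst = a := by
  have : (TrivSqZeroExt.fstHom k (RestrEnv p k L) (RestrEnv p k L)).comp (dualHom r hr)
      = AlgHom.id k _ := by
    apply hom_ext
    intro x
    simp [dualHom]
  exact AlgHom.congr_fun this a

/-- The unique derivation of `u(L)` which extends a linear endomorphism `r` of `L` with
`r (x^[p]) = 0` for all `x`. -/
def deriv (r : L →ₗ[k] L) (hr : ∀ x, r (ppow p k x) = 0) :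
    Derivation k (RestrEnv p k L) (RestrEnv p k L) :=
  Derivation.mk' ((TrivSqZeroExt.sndHom (RestrEnv p k L) (RestrEnv p k L)).restrictScalars k
      ∘ₗ (dualHom r hr).toLinearMap) (by
    intro a b
    simp [fst_dualHom, mul_comm b])

theorem deriv_ι (r : L →ₗ[k] L) (hr : ∀ x, r (ppow p k x) = 0) (x : L) :
    deriv r hr (ι p k L x) = ι p k L (r x) := by
  simp [deriv, dualHom]

/-- Induction principle for `u(L)`. -/
theorem induct {P : RestrEnv p k L → Prop} (h0 : ∀ c : k, P (algebraMap k _ c))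
    (h1 : ∀ x, P (ι p k L x)) (hm : ∀ a b, P a → P b → P (a * b))
    (ha : ∀ a b, P a → P b → P (a + b)) (a : RestrEnv p k L) : P a := by
  obtain ⟨b, rfl⟩ := Ideal.Quotient.mk_surjective a
  change P (proj p k L b)
  induction b using SymmetricAlgebra.induction with
  | algebraMap c => rw [AlgHom.commutes]; exact h0 c
  | ι x => exact h1 x
  | mul a b iha ihb => rw [map_mul]; exact hm _ _ iha ihb
  | add a b iha ihb => rw [map_add]; exact ha _ _ iha ihb

theorem deriv_compat (r : L →ₗ[k] L) (hr : ∀ x, r (ppow p k x) = 0) :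
    Cobar.Compat (deriv r hr : RestrEnv p k L →ₗ[k] RestrEnv p k L) where
  map_one := (deriv r hr).map_one_eq_zero
  comul := by
    have key : ∀ x y : RestrEnv p k L ⊗[k] RestrEnv p k L,
        Cobar.diag2 (deriv r hr : RestrEnv p k L →ₗ[k] RestrEnv p k L) (x * y)
        = x * Cobar.diag2 (deriv r hr : RestrEnv p k L →ₗ[k] RestrEnv p k L) y
          + y * Cobar.diag2 (deriv r hr : RestrEnv p k L →ₗ[k] RestrEnv p k L) x := by
      intro x y
      induction x with
      | zero => simp
      | add a b ha hb => simp only [add_mul, map_add, ha, hb, mul_add]; abel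
      | tmul a b =>
        induction y with
        | zero => simp
        | add c d hc hd => simp only [add_mul, map_add, hc, hd, mul_add]; abel
        | tmul c d =>
          simp [Cobar.diag2, TensorProduct.add_tmul, TensorProduct.tmul_add, mul_add,
            mul_comm c a, mul_comm d b]
          abel
    apply LinearMap.ext
    intro a
    induction a using induct with
    | h0 c => simp [Cobar.diag2, Algebra.TensorProduct.algebraMap_apply,
        Algebra.algebraMap_eq_smul_one, Algebra.TensorProduct.one_def]
    | h1 x => simp [Cobar.diag2, deriv_ι, comul_ι]
    | hm a b ha hb =>
      simp only [LinearMap.comp_apply, Derivation.coeFn_coe] at ha hb ⊢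
      rw [Derivation.leibniz, Bialgebra.comul_mul, key, map_add, smul_eq_mul, smul_eq_mul,
        Bialgebra.comul_mul, Bialgebra.comul_mul, ha, hb]
    | ha a b ha hb => rw [map_add, map_add, ha, hb]
  counit := by
    apply LinearMap.ext
    intro a
    induction a using induct with
    | h0 c => simp
    | h1 x => simp [deriv_ι, counit_ι]
    | hm a b ha hb =>
      simp only [LinearMap.comp_apply, Derivation.coeFn_coe, LinearMap.zero_apply] at ha hb ⊢
      simp [Bialgebra.counit_mul, ha, hb]
    | ha a b ha hb => rw [map_add, map_add, ha, hb]

/-- The endomorphism of `u(L)` induced by a restricted Lie algebra map `L → L`. -/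
def map (f : L →ₗ[k] L) (hf : ∀ x, f (ppow p k x) = ppow p k (f x)) :
    RestrEnv p k L →ₐ[k] RestrEnv p k L :=
  lift (ι p k L ∘ₗ f) (by intro x; simp [ι_pow, hf])

theorem map_ι (f : L →ₗ[k] L) (hf : ∀ x, f (ppow p k x) = ppow p k (f x)) (x : L) :
    map f hf (ι p k L x) = ι p k L (f x) := lift_ι _ _ x

theorem map_isBialgMap (f : L →ₗ[k] L) (hf : ∀ x, f (ppow p k x) = ppow p k (f x)) :
    Cobar.IsBialgMap (map f hf) where
  comul := by apply hom_ext; intro x; simp [comul_ι, map_ι]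
  counit := by apply hom_ext; intro x; simp [counit_ι, map_ι]

end RestrEnv

/-- `L` is a torus: it is abelian, and every element of `L` is semisimple in `u(L)`, that is,
generates a semisimple subalgebra of `u(L)`. -/
def IsTorus [Fact p.Prime] [CharP k p] : Prop :=
  ∀ x : L, IsSemisimpleRing (Algebra.adjoin k {RestrEnv.ι p k L x})

end RestrEnv

/-! ## Types `(𝔤, 𝔥, ρ)` -/

/-- A type `T = (𝔤, 𝔥, ρ)` together with a generator `z` of `𝔤`: here `𝔤` is one-dimensional,
`𝔤` and `𝔥` are abelian restricted Lie algebras, and `ρ` is an algebraic representation of `𝔤` on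
`𝔥`.  As the brackets vanish, the condition `ρ_x (a^[p]) = ρ_x (a) (ad a)^(p-1)` reads
`ρ_x (a^[p]) = 0`, and the derivation property `ρ_x [a, b] = [ρ_x a, b] + [a, ρ_x b]` is void.
The scalar `lam` is determined by the generator through `z^[p] + lam z = 0`. -/
structure HopfType (p : ℕ) (k g h : Type*) [Field k] [AddCommGroup g] [Module k g]
    [AbRestrictedLie p k g] [AddCommGroup h] [Module k h] [AbRestrictedLie p k h] where
  finrank_eq_one : Module.finrank k g = 1
  /-- The representation. -/
  ρ : g →ₗ[k] Module.End k h
  ρ_bracket : ∀ x y, ρ x * ρ y - ρ y * ρ x = 0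
  ρ_ppow : ∀ x, ρ (ppow p k x) = ρ x ^ p
  ρ_apply_ppow : ∀ x a, ρ x (ppow p k a) = 0
  /-- The generator of `𝔤`. -/
  z : g
  z_ne_zero : z ≠ 0
  /-- The scalar `λ` in `z^[p] + λ z = 0`. -/
  lam : k
  z_rel : ppow p k z + lam • z = 0

namespace HopfType

variable {p : ℕ} {k g h : Type*} [Field k] [AddCommGroup g] [Module k g]
    [AbRestrictedLie p k g] [AddCommGroup h] [Module k h] [AbRestrictedLie p k h]

/-! ### The automorphism group -/

section Aut

variable (T : HopfType p k g h)

theorem exists_scalar (α : g →ₗ[k] g) (x : g) :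
    α x = (LinearEquiv.smul_id_of_finrank_eq_one T.finrank_eq_one).symm α • x := by
  have := (LinearEquiv.smul_id_of_finrank_eq_one T.finrank_eq_one).apply_symm_apply α
  exact (LinearMap.congr_fun this x).symm

/-- `Aut(T)`: pairs `(α, β)` of automorphisms of the restricted Lie algebras `𝔤` and `𝔥` such that
`ρ_x (β y) = β (ρ_{α x} y)`. -/
def Aut : Subgroup ((g ≃ₗ[k] g) × (h ≃ₗ[k] h)) where
  carrier := {s | (∀ x, s.1 (ppow p k x) = ppow p k (s.1 x)) ∧
    (∀ y, s.2 (ppow p k y) = ppow p k (s.2 y)) ∧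
    ∀ x y, T.ρ x (s.2 y) = s.2 (T.ρ (s.1 x) y)}
  one_mem' := ⟨fun _ => rfl, fun _ => rfl, fun _ _ => rfl⟩
  mul_mem' := by
    rintro s t ⟨h1, h2, h3⟩ ⟨h1', h2', h3'⟩
    refine ⟨fun x => ?_, fun x => ?_, fun x y => ?_⟩
    · change s.1 (t.1 _) = ppow p k (s.1 (t.1 x))
      rw [h1', h1]
    · change s.2 (t.2 _) = ppow p k (s.2 (t.2 x))
      rw [h2', h2]
    · change T.ρ x (s.2 (t.2 y)) = s.2 (t.2 (T.ρ (s.1 (t.1 x)) y))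
      have hc : s.1 (t.1 x) = t.1 (s.1 x) := by
        have e1 := T.exists_scalar s.1.toLinearMap
        have e2 := T.exists_scalar t.1.toLinearMap
        simp only [LinearEquiv.coe_coe] at e1 e2
        rw [e1 (t.1 x), e2 x, e1 x, e2, smul_comm]
      rw [h3, h3', hc]
  inv_mem' := by
    rintro s ⟨h1, h2, h3⟩
    refine ⟨fun x => ?_, fun x => ?_, fun x y => ?_⟩
    · change s.1.symm _ = ppow p k (s.1.symm x)
      rw [LinearEquiv.symm_apply_eq, h1, LinearEquiv.apply_symm_apply]
    · change s.2.symm _ = ppow p k (s.2.symm x)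
      rw [LinearEquiv.symm_apply_eq, h2, LinearEquiv.apply_symm_apply]
    · change T.ρ x (s.2.symm y) = s.2.symm (T.ρ (s.1.symm x) y)
      rw [LinearEquiv.eq_symm_apply]
      have := h3 (s.1.symm x) (s.2.symm y)
      rw [LinearEquiv.apply_symm_apply, LinearEquiv.apply_symm_apply] at this
      exact this.symm

variable {T}

/-- The character `γ : Aut(T) → kˣ` with `σ(z) = γ_σ z` (as a scalar). -/
def gam (σ : T.Aut) : k :=
  (LinearEquiv.smul_id_of_finrank_eq_one T.finrank_eq_one).symm σ.1.1.toLinearMap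

theorem gam_spec (σ : T.Aut) (x : g) : σ.1.1 x = gam σ • x :=
  T.exists_scalar σ.1.1.toLinearMap x

theorem gam_unique {σ : T.Aut} {c : k} (hc : σ.1.1 T.z = c • T.z) : gam σ = c := by
  rw [gam_spec] at hc
  exact smul_left_injective k T.z_ne_zero hc

theorem gam_one : gam (1 : T.Aut) = 1 := gam_unique (by simp)

theorem gam_mul (σ τ : T.Aut) : gam (σ * τ) = gam σ * gam τ := gam_unique (by
  change σ.1.1 (τ.1.1 T.z) = _
  rw [gam_spec τ, gam_spec σ, smul_smul, mul_comm])

theorem gam_lam (σ : T.Aut) : gam σ ^ p * T.lam = gam σ * T.lam := by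
  have h1 := σ.2.1 T.z
  have hz : ppow p k T.z = -(T.lam • T.z) := eq_neg_of_add_eq_zero_left T.z_rel
  have hs : ppow p k (gam σ • T.z) = gam σ ^ p • ppow p k T.z := AbRestrictedLie.pMap_smul _ _
  rw [gam_spec, gam_spec, hs, hz, smul_neg, smul_neg, neg_inj, smul_smul, smul_smul] at h1
  exact (smul_left_injective k T.z_ne_zero h1).symm

variable [Fact p.Prime] [CharP k p]

/-- The automorphism of `A = u(𝔥)` induced by an automorphism of `T`. -/
def autA (σ : T.Aut) : RestrEnv p k h →ₐ[k] RestrEnv p k h :=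
  RestrEnv.map σ.1.2.toLinearMap σ.2.2.1

theorem autA_ι (σ : T.Aut) (x : h) :
    autA σ (RestrEnv.ι p k h x) = RestrEnv.ι p k h (σ.1.2 x) :=
  RestrEnv.map_ι _ _ x

theorem autA_isBialgMap (σ : T.Aut) : Cobar.IsBialgMap (autA σ) := RestrEnv.map_isBialgMap _ _

theorem autA_one : autA (1 : T.Aut) = AlgHom.id k _ := by
  apply RestrEnv.hom_ext
  intro x
  rw [autA_ι]; rfl

theorem autA_mul (σ τ : T.Aut) : autA (σ * τ) = (autA σ).comp (autA τ) := by
  apply RestrEnv.hom_ext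
  intro x
  rw [AlgHom.comp_apply, autA_ι, autA_ι, autA_ι]; rfl

end Aut

/-! ### The operators `ρ_z` and `Φ_z` -/

variable [Fact p.Prime] [CharP k p] (T : HopfType p k g h)

/-- The action of `z` on `A = u(𝔥)`: the derivation which extends `ρ_z`. -/
def δ : RestrEnv p k h →ₗ[k] RestrEnv p k h :=
  (RestrEnv.deriv (T.ρ T.z) (T.ρ_apply_ppow T.z) : RestrEnv p k h →ₗ[k] RestrEnv p k h)

theorem δ_compat : Cobar.Compat T.δ := RestrEnv.deriv_compat _ _

theorem δ_ι (x : h) : T.δ (RestrEnv.ι p k h x) = RestrEnv.ι p k h (T.ρ T.z x) :=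
  RestrEnv.deriv_ι _ _ x

theorem δ_autA (σ : T.Aut) (a : RestrEnv p k h) : T.δ (autA σ a) = gam σ • autA σ (T.δ a) := by
  induction a using RestrEnv.induct with
  | h0 c => simp [δ]
  | h1 x =>
    rw [autA_ι, δ_ι, δ_ι, autA_ι, σ.2.2.2, gam_spec]
    simp
  | hm a b ha hb =>
    have hl : ∀ a b, T.δ (a * b) = a * T.δ b + b * T.δ a := fun a b =>
      (RestrEnv.deriv (T.ρ T.z) (T.ρ_apply_ppow T.z)).leibniz a b
    rw [map_mul, hl, hl, ha, hb, map_add, map_mul, map_mul, smul_add, mul_smul_comm, mul_smul_comm]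
  | ha a b ha hb => rw [map_add, map_add, ha, hb, map_add, map_add, smul_add]

/-- The operator `Φ_z` on `𝔥`, that is, `x ↦ x^[p] + λ x + ρ_z ^ (p - 1) x`. -/
def phiLie (x : h) : h := ppow p k x + T.lam • x + (T.ρ T.z ^ (p - 1)) x

/-- The operator `Φ_z` on `A`. -/
def phi1 : RestrEnv p k h → RestrEnv p k h := Cobar.zOp p T.lam T.δ

/-- The operator `Φ_z` on `A ⊗ A`. -/
def phi2 : RestrEnv p k h ⊗[k] RestrEnv p k h → RestrEnv p k h ⊗[k] RestrEnv p k h :=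
  Cobar.zOp p T.lam (Cobar.diag2 T.δ)

/-- The operator `Φ_z` on `H²(Ω A)`. -/
def phiH2 : Cobar.H2 k (RestrEnv p k h) → Cobar.H2 k (RestrEnv p k h) :=
  Cobar.zOpH2 p T.lam T.δ_compat

theorem phi1_ι (x : h) : T.phi1 (RestrEnv.ι p k h x) = RestrEnv.ι p k h (T.phiLie x) := by
  have hc : T.δ ∘ₗ RestrEnv.ι p k h = RestrEnv.ι p k h ∘ₗ T.ρ T.z := LinearMap.ext T.δ_ι
  have := LinearMap.congr_fun (Module.End.commute_pow_left_of_commute hc (p - 1)) x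
  simp only [LinearMap.comp_apply] at this
  simp [phi1, phiLie, Cobar.zOp, this, RestrEnv.ι_pow]

theorem phi1_act (σ : T.Aut) (a : RestrEnv p k h) :
    T.phi1 (gam σ • autA σ a) = gam σ ^ p • autA σ (T.phi1 a) :=
  Cobar.zOp_twist _ (gam_lam σ) (T.δ_autA σ) a

theorem phi2_act (σ : T.Aut) (x : RestrEnv p k h ⊗[k] RestrEnv p k h) :
    T.phi2 (gam σ • Cobar.map2 (autA σ) x) = gam σ ^ p • Cobar.map2 (autA σ) (T.phi2 x) :=
  Cobar.zOp_twist _ (gam_lam σ) (Cobar.diag2_twist (T.δ_autA σ)) x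

/-! ### The cohomology set `𝓗²(T)` -/

/-- The set `𝓔²(B, A)` of all pairs `(Θ, χ) ∈ A⁺ × Z²(Ω A)` with `ρ_z(Θ) = 0` and
`Φ_z(χ) = d¹(Θ)`. -/
def E2 : Set (RestrEnv p k h × Cobar.Z2 k (RestrEnv p k h)) :=
  {x | x.1 ∈ Cobar.augIdeal k (RestrEnv p k h) ∧ T.δ x.1 = 0 ∧ T.phi2 x.2 = Cobar.d1 k x.1}

/-- The equivalence relation on `𝓔²(B, A)`: `(Θ', χ') ∼ (Θ, χ)` iff there is `a ∈ A⁺` with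
`Θ' - Θ = Φ_z(a)` and `χ' - χ = d¹(a)`. -/
def E2Setoid : Setoid T.E2 where
  r x y := ∃ a ∈ Cobar.augIdeal k (RestrEnv p k h), x.1.1 - y.1.1 = T.phi1 a ∧
    (x.1.2 : RestrEnv p k h ⊗[k] RestrEnv p k h) - y.1.2 = Cobar.d1 k a
  iseqv :=
    { refl := fun x => ⟨0, zero_mem _,
        by simp [phi1, Cobar.zOp, (Fact.out : p.Prime).ne_zero], by simp⟩
      symm := by
        rintro x y ⟨a, ha, h1, h2⟩
        refine ⟨0 - a, sub_mem (zero_mem _) ha, ?_, ?_⟩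
        · rw [phi1, Cobar.zOp_sub, ← phi1, ← h1]
          simp [phi1, Cobar.zOp, (Fact.out : p.Prime).ne_zero]
        · rw [map_sub, ← h2]; simp
      trans := by
        rintro x y w ⟨a, ha, h1, h2⟩ ⟨b, hb, h3, h4⟩
        refine ⟨a + b, add_mem ha hb, ?_, ?_⟩
        · rw [phi1, Cobar.zOp_add, ← phi1, ← h1, ← h3]; abel
        · rw [map_add, ← h2, ← h4]; abel }

/-- `𝓗²(B, A) = 𝓔²(B, A) / ∼`. -/
def HBA : Type _ := Quotient T.E2Setoid

/-- `𝓗²(𝔤, 𝔥)`, as a subset of `𝓗²(B, A)`: the classes of the pairs with `χ ∈ B²(Ω A)`. -/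
def HLie : Set T.HBA :=
  {c | ∃ x : T.E2, (x.1.2 : RestrEnv p k h ⊗[k] RestrEnv p k h) ∈ Cobar.B2 k (RestrEnv p k h) ∧
    Quotient.mk T.E2Setoid x = c}

/-- `𝓗²(T) = 𝓗²(B, A) ∖ 𝓗²(𝔤, 𝔥)`. -/
def HT : Type _ := {c : T.HBA // c ∉ T.HLie}

/-! ### The projection `q` -/

/-- `[(Θ, χ)] ↦ [χ]` on `𝓗²(B, A)`. -/
def qBA : T.HBA → Cobar.H2 k (RestrEnv p k h) :=
  Quotient.lift (fun x : T.E2 => Cobar.cls x.1.2) (by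
    rintro x y ⟨a, ha, -, h2⟩
    exact Cobar.cls_eq.2 ⟨a, ha, h2.symm⟩)

/-- The `z`-characteristic elements of `H²(Ω A)`. -/
def zChar : Set (Cobar.H2 k (RestrEnv p k h)) := {ξ | T.phiH2 ξ = 0}

/-- The admissible elements of `H²(Ω A)`: those represented by a cocycle `χ` for which there is
`a ∈ A⁺` with `Φ_z(χ) = d¹(a)` and `ρ_z(a) = 0`. -/
def adm : Set (Cobar.H2 k (RestrEnv p k h)) :=
  {ξ | ∃ χ : Cobar.Z2 k (RestrEnv p k h), Cobar.cls χ = ξ ∧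
    ∃ a ∈ Cobar.augIdeal k (RestrEnv p k h), T.phi2 χ = Cobar.d1 k a ∧ T.δ a = 0}

theorem mem_zChar_iff (χ : Cobar.Z2 k (RestrEnv p k h)) :
    Cobar.cls χ ∈ T.zChar ↔ T.phi2 χ ∈ Cobar.B2 k (RestrEnv p k h) := by
  change Cobar.cls (Cobar.zOpZ2 p T.lam T.δ_compat χ) = Cobar.cls 0 ↔ _
  rw [Cobar.cls_eq]
  simp [Cobar.zOpZ2, phi2]

theorem adm_subset_zChar : T.adm ⊆ T.zChar := by
  rintro _ ⟨χ, rfl, a, ha, h1, -⟩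
  exact (T.mem_zChar_iff χ).2 ⟨a, ha, h1.symm⟩

/-- `𝒜²(Ω A) ∖ {0}`. -/
def AdmNZ : Type _ := {ξ : Cobar.H2 k (RestrEnv p k h) // ξ ∈ T.adm ∧ ξ ≠ 0}

/-- The nonzero `z`-characteristic elements. -/
def ZCharNZ : Type _ := {ξ : Cobar.H2 k (RestrEnv p k h) // ξ ∈ T.zChar ∧ ξ ≠ 0}

theorem qBA_mem (c : T.HT) : T.qBA c.1 ∈ T.adm ∧ T.qBA c.1 ≠ 0 := by
  obtain ⟨c, hc⟩ := c
  induction c using Quotient.inductionOn with | h x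
  refine ⟨⟨x.1.2, rfl, x.1.1, x.2.1, x.2.2.2, x.2.2.1⟩, fun h0 => hc ⟨x, ?_, rfl⟩⟩
  have := Cobar.cls_eq.1 (show Cobar.cls x.1.2 = Cobar.cls 0 from h0)
  simpa using this

/-- The projection `q : 𝓗²(T) → 𝒜²(Ω A) ∖ {0}`, `[(Θ, χ)] ↦ [χ]`. -/
def q (c : T.HT) : T.AdmNZ := ⟨T.qBA c.1, T.qBA_mem c⟩

/-- The projection `q`, with values in the nonzero `z`-characteristic elements. -/
def qZ (c : T.HT) : T.ZCharNZ :=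
  ⟨T.qBA c.1, T.adm_subset_zChar (T.qBA_mem c).1, (T.qBA_mem c).2⟩

/-! ### The actions of `Aut(T)` -/

/-- `σ.(Θ, χ) = (γ^p σ(Θ), γ (σ ⊗ σ)(χ))` on `𝓔²(B, A)`. -/
instance : MulAction T.Aut T.E2 where
  smul σ x := ⟨(gam σ ^ p • autA σ x.1.1, Cobar.actZ2 (gam σ) (autA_isBialgMap σ) x.1.2), by
    obtain ⟨⟨t, χ⟩, h1, h2, h3⟩ := x
    simp only at h1 h2 h3
    refine ⟨Submodule.smul_mem _ _ ((autA_isBialgMap σ).mem_augIdeal h1), ?_, ?_⟩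
    · simp [δ_autA, h2]
    · change T.phi2 (gam σ • Cobar.map2 (autA σ) χ) = Cobar.d1 k (gam σ ^ p • autA σ t)
      rw [phi2_act, map_smul, ← (autA_isBialgMap σ).d1_map, h3]⟩
  one_smul x := by
    apply Subtype.ext
    apply Prod.ext
    · change gam (1 : T.Aut) ^ p • autA (1 : T.Aut) x.1.1 = x.1.1
      rw [gam_one, autA_one, one_pow, one_smul]; rfl
    · apply Subtype.ext
      change gam (1 : T.Aut) • Cobar.map2 (autA (1 : T.Aut)) x.1.2 = x.1.2
      rw [gam_one, autA_one, one_smul, Cobar.map2, Algebra.TensorProduct.map_id]; rfl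
  mul_smul σ τ x := by
    apply Subtype.ext
    apply Prod.ext
    · change gam (σ * τ) ^ p • autA (σ * τ) x.1.1
        = gam σ ^ p • autA σ (gam τ ^ p • autA τ x.1.1)
      rw [gam_mul, autA_mul, map_smul, smul_smul, mul_pow]; rfl
    · apply Subtype.ext
      change gam (σ * τ) • Cobar.map2 (autA (σ * τ)) x.1.2
        = gam σ • Cobar.map2 (autA σ) (gam τ • Cobar.map2 (autA τ) x.1.2)
      rw [gam_mul, autA_mul, map_smul, smul_smul, Cobar.map2, Algebra.TensorProduct.map_comp]; rfl

theorem act_rel (σ : T.Aut) {x y : T.E2} (hxy : T.E2Setoid x y) :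
    T.E2Setoid (σ • x) (σ • y) := by
  obtain ⟨a, ha, h1, h2⟩ := hxy
  refine ⟨gam σ • autA σ a, Submodule.smul_mem _ _ ((autA_isBialgMap σ).mem_augIdeal ha), ?_, ?_⟩
  · rw [phi1_act, ← h1, map_sub, smul_sub]; rfl
  · rw [map_smul, ← (autA_isBialgMap σ).d1_map, ← h2, map_sub, smul_sub]; rfl

/-- The induced action on `𝓗²(B, A)`. -/
instance : MulAction T.Aut T.HBA where
  smul σ := Quotient.map (fun x : T.E2 => σ • x) (fun _ _ hxy => T.act_rel σ hxy)
  one_smul c := by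
    induction c using Quotient.inductionOn with | h x
    exact congrArg (Quotient.mk T.E2Setoid) (one_smul T.Aut x)
  mul_smul σ τ c := by
    induction c using Quotient.inductionOn with | h x
    exact congrArg (Quotient.mk T.E2Setoid) (mul_smul σ τ x)

theorem smul_mem_HLie (σ : T.Aut) {c : T.HBA} (hc : c ∈ T.HLie) : σ • c ∈ T.HLie := by
  obtain ⟨x, hx, rfl⟩ := hc
  exact ⟨σ • x, Submodule.smul_mem _ _ ((autA_isBialgMap σ).mem_B2 hx), rfl⟩

/-- The induced action on `𝓗²(T)`. -/
instance : MulAction T.Aut T.HT where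
  smul σ c := ⟨σ • c.1, fun hc => c.2 (by
    have := T.smul_mem_HLie σ⁻¹ hc
    rwa [inv_smul_smul] at this)⟩
  one_smul c := Subtype.ext (one_smul _ c.1)
  mul_smul σ τ c := Subtype.ext (mul_smul σ τ c.1)

/-- The action `σ.[χ] = [γ (σ ⊗ σ)(χ)]` of `Aut(T)` on `H²(Ω A)`. -/
def actH (σ : T.Aut) : Cobar.H2 k (RestrEnv p k h) →ₗ[k] Cobar.H2 k (RestrEnv p k h) :=
  Cobar.actH2 (gam σ) (autA_isBialgMap σ)

theorem actH_cls (σ : T.Aut) (χ : Cobar.Z2 k (RestrEnv p k h)) :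
    T.actH σ (Cobar.cls χ) = Cobar.cls (Cobar.actZ2 (gam σ) (autA_isBialgMap σ) χ) := rfl

theorem actH_one (ξ : Cobar.H2 k (RestrEnv p k h)) : T.actH 1 ξ = ξ := by
  obtain ⟨χ, rfl⟩ := Submodule.Quotient.mk_surjective _ ξ
  refine congrArg Cobar.cls (Subtype.ext ?_)
  change gam (1 : T.Aut) • Cobar.map2 (autA (1 : T.Aut)) χ = χ
  rw [gam_one, autA_one, one_smul, Cobar.map2, Algebra.TensorProduct.map_id]; rfl

theorem actH_mul (σ τ : T.Aut) (ξ : Cobar.H2 k (RestrEnv p k h)) :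
    T.actH (σ * τ) ξ = T.actH σ (T.actH τ ξ) := by
  obtain ⟨χ, rfl⟩ := Submodule.Quotient.mk_surjective _ ξ
  refine congrArg Cobar.cls (Subtype.ext ?_)
  change gam (σ * τ) • Cobar.map2 (autA (σ * τ)) χ
    = gam σ • Cobar.map2 (autA σ) (gam τ • Cobar.map2 (autA τ) χ)
  rw [gam_mul, autA_mul, map_smul, smul_smul, Cobar.map2, Algebra.TensorProduct.map_comp]; rfl

theorem actH_ne_zero (σ : T.Aut) {ξ : Cobar.H2 k (RestrEnv p k h)} (hξ : ξ ≠ 0) :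
    T.actH σ ξ ≠ 0 := by
  intro h0
  apply hξ
  rw [← T.actH_one ξ, ← inv_mul_cancel σ, actH_mul, h0, map_zero]

theorem actH_zChar (σ : T.Aut) {ξ : Cobar.H2 k (RestrEnv p k h)} (hξ : ξ ∈ T.zChar) :
    T.actH σ ξ ∈ T.zChar := by
  obtain ⟨χ, rfl⟩ := Submodule.Quotient.mk_surjective _ ξ
  change Cobar.cls _ ∈ T.zChar
  change Cobar.cls χ ∈ T.zChar at hξ
  rw [mem_zChar_iff] at hξ ⊢
  change T.phi2 (gam σ • Cobar.map2 (autA σ) χ) ∈ _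
  rw [phi2_act]
  exact Submodule.smul_mem _ _ ((autA_isBialgMap σ).mem_B2 hξ)

theorem actH_adm (σ : T.Aut) {ξ : Cobar.H2 k (RestrEnv p k h)} (hξ : ξ ∈ T.adm) :
    T.actH σ ξ ∈ T.adm := by
  obtain ⟨χ, rfl, a, ha, h1, h2⟩ := hξ
  refine ⟨_, (T.actH_cls σ χ).symm, gam σ ^ p • autA σ a,
    Submodule.smul_mem _ _ ((autA_isBialgMap σ).mem_augIdeal ha), ?_, ?_⟩
  · change T.phi2 (gam σ • Cobar.map2 (autA σ) χ) = _
    rw [phi2_act, map_smul, ← (autA_isBialgMap σ).d1_map, h1]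
  · simp [δ_autA, h2]

/-- The induced action on the nonzero admissible elements. -/
instance : MulAction T.Aut T.AdmNZ where
  smul σ ξ := ⟨T.actH σ ξ.1, T.actH_adm σ ξ.2.1, T.actH_ne_zero σ ξ.2.2⟩
  one_smul ξ := Subtype.ext (T.actH_one ξ.1)
  mul_smul σ τ ξ := Subtype.ext (T.actH_mul σ τ ξ.1)

/-- The induced action on the nonzero `z`-characteristic elements. -/
instance : MulAction T.Aut T.ZCharNZ where
  smul σ ξ := ⟨T.actH σ ξ.1, T.actH_zChar σ ξ.2.1, T.actH_ne_zero σ ξ.2.2⟩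
  one_smul ξ := Subtype.ext (T.actH_one ξ.1)
  mul_smul σ τ ξ := Subtype.ext (T.actH_mul σ τ ξ.1)

theorem qBA_smul (σ : T.Aut) (c : T.HBA) : T.qBA (σ • c) = T.actH σ (T.qBA c) := by
  induction c using Quotient.inductionOn with | h x
  rfl

theorem q_smul (σ : T.Aut) (c : T.HT) : T.q (σ • c) = σ • T.q c :=
  Subtype.ext (T.qBA_smul σ c.1)

theorem qZ_smul (σ : T.Aut) (c : T.HT) : T.qZ (σ • c) = σ • T.qZ c :=
  Subtype.ext (T.qBA_smul σ c.1)

/-- The map induced by `q` from the `Aut(T)`-orbits in `𝓗²(T)` to the `Aut(T)`-orbits in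
`𝒜²(Ω A) ∖ {0}`. -/
def qOrbits : MulAction.orbitRel.Quotient T.Aut T.HT → MulAction.orbitRel.Quotient T.Aut T.AdmNZ :=
  Quotient.map T.q (by
    rintro _ c ⟨σ, rfl⟩
    exact ⟨σ, (T.q_smul σ c).symm⟩)

/-- The map induced by `q` from the `Aut(T)`-orbits in `𝓗²(T)` to the `Aut(T)`-orbits of nonzero
`z`-characteristic elements. -/
def qZOrbits :
    MulAction.orbitRel.Quotient T.Aut T.HT → MulAction.orbitRel.Quotient T.Aut T.ZCharNZ :=
  Quotient.map T.qZ (by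
    rintro _ c ⟨σ, rfl⟩
    exact ⟨σ, (T.qZ_smul σ c).symm⟩)

end HopfType

end

/-!
Write `A = u(𝔥)`.  The projection `q` is analysed before passing to orbits: under the hypothesis
`ker ρ_z = Φ_z(𝔥)` it is an equivariant bijection, which then descends to orbits.

Surjectivity onto the admissible classes is built into their definition.  For injectivity
(`HopfType.qBA_injective`), two pairs with cohomologous cocycles may be assumed to have the same
cocycle; then the first components differ by a primitive element of `A` that is killed by `ρ_z`.
The primitive elements of `A` are those of `𝔥` (`RestrEnv.exists_ι_of_d1_eq_zero`), so by
hypothesis the difference is `Φ_z(y)` for some `y ∈ 𝔥`, and as `d¹(y) = 0` the pairs are equivalent.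

For tori, let `Φ_z(χ) = d¹(a)`.  As `ρ_z` acts by derivations with `ρ_z ^ p = -λ ρ_z`, it kills
`Φ_z(χ)`, so `ρ_z(a)` is primitive, say equal to `y ∈ 𝔥`.  If `𝔤` is a torus, then `λ ≠ 0`, and
`ρ_z ^ p = -λ ρ_z` shows that `y = -ρ_z(x)` for some `x ∈ 𝔥`; replacing `a` by `a + x` shows that
the class of `χ` is admissible.  If `𝔥` is a torus, its `p`-map is injective, hence surjective since
`k` is perfect, and `ρ_z` vanishes because it kills all `p`-th powers (`HopfType.zChar_subset_adm`).

The description of the primitive elements rests on the Poincaré–Birkhoff–Witt theorem for `u(𝔥)`: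
the monomials in a basis of `𝔥` with all exponents less than `p` form a basis of `u(𝔥)`.  The
rewriting rule `b i ^ p ↦ (b i)^[p]` lowers the degree and is confluent (`RestrEnv.nf_eq`), so that
there is a well-defined normal form map on `u(𝔥)`, and the restricted monomials are linearly
independent.  The binomial theorem gives the comultiplication on them.
-/

noncomputable section

/-! ### A monomial basis of the restricted enveloping algebra -/

namespace RestrEnv

section NormalForm

variable {p : ℕ} {k L I : Type*} [Field k] [AddCommGroup L] [Module k L] [AbRestrictedLie p k L]

theorem equivMvPolynomial_ι (b : Module.Basis I k L) (y : L) :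
    SymmetricAlgebra.equivMvPolynomial b (SymmetricAlgebra.ι k L y) =
    (b.repr y).sum fun j c => c • MvPolynomial.X j := by
  conv_lhs => rw [← b.linearCombination_repr y]
  simp [Finsupp.linearCombination_apply, Finsupp.sum, map_sum]

/-- The monomial with exponent `α` in a basis of `L`, as an element of `u(L)`. -/
def mono (b : Module.Basis I k L) (α : I →₀ ℕ) : RestrEnv p k L :=
  α.prod fun i n => ι p k L (b i) ^ n

theorem mono_zero (b : Module.Basis I k L) : mono (p := p) b 0 = 1 := Finsupp.prod_zero_index

theorem mono_single_pow (b : Module.Basis I k L) (i : I) (n : ℕ) :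
    mono (p := p) b (Finsupp.single i n) = ι p k L (b i) ^ n :=
  Finsupp.prod_single_index (pow_zero _)

theorem mono_single (b : Module.Basis I k L) (i : I) :
    mono (p := p) b (Finsupp.single i 1) = ι p k L (b i) := by
  rw [mono_single_pow, pow_one]

theorem mono_add (b : Module.Basis I k L) (α β : I →₀ ℕ) :
    mono (p := p) b (α + β) = mono b α * mono b β :=
  Finsupp.prod_add_index' (fun _ => pow_zero _) fun _ => pow_add _

theorem proj_equivMvPolynomial_symm (b : Module.Basis I k L) (f : MvPolynomial I k) :
    proj p k L ((SymmetricAlgebra.equivMvPolynomial b).symm f) =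
      MvPolynomial.aeval (fun i => ι p k L (b i)) f := by
  have : (proj p k L).comp (SymmetricAlgebra.equivMvPolynomial b).symm.toAlgHom =
      MvPolynomial.aeval (fun i => ι p k L (b i)) := by
    ext i
    simp [ι]
  exact AlgHom.congr_fun this f

theorem proj_monomial (b : Module.Basis I k L) (α : I →₀ ℕ) (c : k) :
    proj p k L ((SymmetricAlgebra.equivMvPolynomial b).symm (MvPolynomial.monomial α c)) =
      c • mono b α := by
  rw [proj_equivMvPolynomial_symm, MvPolynomial.aeval_monomial, mono, Algebra.smul_def]

theorem degree_rewrite_lt [Fact p.Prime] {α : I →₀ ℕ} {i : I} (hi : p ≤ α i) (j : I) :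
    (α - Finsupp.single i p + Finsupp.single j 1).degree < α.degree := by
  have h1 : α - Finsupp.single i p + Finsupp.single i p = α :=
    tsub_add_cancel_of_le (Finsupp.single_le_iff.2 hi)
  have h2 := congrArg Finsupp.degree h1
  have h3 := (Fact.out : p.Prime).two_le
  simp only [map_add, Finsupp.degree_single] at h2 ⊢
  omega

open Classical in
/-- The normal form of the monomial with exponent `α` in a basis `b` of `L`: as long as some
exponent is at least `p`, the power `b i ^ p` is replaced by the linear form `(b i)^[p]`.  The
index `i` is chosen arbitrarily; by `nf_eq` the result does not depend on it. -/
def nf [Fact p.Prime] (b : Module.Basis I k L) (α : I →₀ ℕ) : MvPolynomial I k :=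
  if h : ∃ i, p ≤ α i then
    (b.repr (ppow p k (b h.choose))).sum fun j c =>
      c • nf b (α - Finsupp.single h.choose p + Finsupp.single j 1)
  else MvPolynomial.monomial α 1
termination_by α.degree
decreasing_by exact degree_rewrite_lt h.choose_spec j

variable [Fact p.Prime] (b : Module.Basis I k L)

theorem nf_of_lt {α : I →₀ ℕ} (h : ∀ i, α i < p) :
    nf (p := p) b α = MvPolynomial.monomial α 1 := by
  rw [nf, dif_neg]
  push Not
  exact h

/-- Confluence of the rewriting: any exponent that is at least `p` may be reduced first. -/
theorem nf_eq {α : I →₀ ℕ} {i : I} (hi : p ≤ α i) :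
    nf (p := p) b α = (b.repr (ppow p k (b i))).sum fun j c =>
      c • nf (p := p) b (α - Finsupp.single i p + Finsupp.single j 1) := by
  induction hn : α.degree using Nat.strong_induction_on generalizing α i with
  | _ n ih =>
    have h : ∃ i, p ≤ α i := ⟨i, hi⟩
    rw [nf, dif_pos h]
    generalize h.choose = i₀, h.choose_spec = h₀
    rcases eq_or_ne i i₀ with rfl | hne
    · rfl
    -- Both `i` and `i₀` can be reduced, in either order, and the two orders agree.
    have e1 : ∀ j, nf (p := p) b (α - Finsupp.single i₀ p + Finsupp.single j 1) =
        (b.repr (ppow p k (b i))).sum fun j' c' => c' • nf (p := p) b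
          (α - Finsupp.single i₀ p + Finsupp.single j 1 - Finsupp.single i p
            + Finsupp.single j' 1) := fun j => by
      refine ih _ (hn ▸ degree_rewrite_lt h₀ j) ?_ rfl
      simp [Finsupp.single_eq_of_ne hne]
      omega
    have e2 : ∀ j, nf (p := p) b (α - Finsupp.single i p + Finsupp.single j 1) =
        (b.repr (ppow p k (b i₀))).sum fun j' c' => c' • nf (p := p) b
          (α - Finsupp.single i p + Finsupp.single j 1 - Finsupp.single i₀ p
            + Finsupp.single j' 1) := fun j => by
      refine ih _ (hn ▸ degree_rewrite_lt hi j) ?_ rfl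
      simp [Finsupp.single_eq_of_ne hne.symm]
      omega
    simp only [e1, e2, Finsupp.smul_sum]
    rw [Finsupp.sum_comm]
    refine Finsupp.sum_congr fun j _ => Finsupp.sum_congr fun j' _ => ?_
    rw [smul_comm]
    congr 3
    ext m
    have h1 : (Finsupp.single i p) m ≤ α m := Finsupp.single_le_iff.2 hi m
    have h2 : (Finsupp.single i₀ p) m ≤ α m := Finsupp.single_le_iff.2 h₀ m
    have h3 : (Finsupp.single i p) m + (Finsupp.single i₀ p) m ≤ α m := by
      by_cases hm : m = i
      · subst hm; simpa [Finsupp.single_eq_of_ne hne] using hi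
      · simpa [Finsupp.single_eq_of_ne hm] using h2
    simp only [Finsupp.coe_add, Finsupp.coe_tsub, Pi.add_apply, Pi.sub_apply]
    omega

/-- The linear extension of the normal form of monomials. -/
def nfPoly : MvPolynomial I k →ₗ[k] MvPolynomial I k :=
  (MvPolynomial.basisMonomials I k).constr k (nf (p := p) b)

theorem nfPoly_monomial (α : I →₀ ℕ) :
    nfPoly (p := p) b (MvPolynomial.monomial α 1) = nf (p := p) b α := by
  have := (MvPolynomial.basisMonomials I k).constr_basis k (nf (p := p) b) α
  rwa [MvPolynomial.coe_basisMonomials] at this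

theorem nfPoly_mul_linear (β : I →₀ ℕ) (y : L) :
    nfPoly (p := p) b (MvPolynomial.monomial β 1 *
      SymmetricAlgebra.equivMvPolynomial b (SymmetricAlgebra.ι k L y)) =
    (b.repr y).sum fun j c => c • nf (p := p) b (β + Finsupp.single j 1) := by
  rw [equivMvPolynomial_ι, Finsupp.sum, Finset.mul_sum, map_sum]
  refine Finset.sum_congr rfl fun j _ => ?_
  rw [mul_smul_comm, map_smul, MvPolynomial.X, MvPolynomial.monomial_mul, one_mul,
    nfPoly_monomial]

/-- The restricted monomials span `u(L)`. -/
theorem span_mono : Submodule.span k (mono (p := p) b '' {α | ∀ i, α i < p}) = ⊤ := by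
  have hm : ∀ n : ℕ, ∀ α : I →₀ ℕ, α.degree = n →
      mono (p := p) b α ∈ Submodule.span k (mono (p := p) b '' {α | ∀ i, α i < p}) := by
    intro n
    induction n using Nat.strong_induction_on with
    | _ n ih =>
      intro α hα
      by_cases h : ∀ i, α i < p
      · exact Submodule.subset_span ⟨α, h, rfl⟩
      push Not at h
      obtain ⟨i, hi⟩ := h
      have h1 : mono (p := p) b α = (b.repr (ppow p k (b i))).sum fun j c =>
          c • mono b (α - Finsupp.single i p + Finsupp.single j 1) := by
        conv_lhs => rw [← tsub_add_cancel_of_le (Finsupp.single_le_iff.2 hi)]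
        have h2 : mono (p := p) b (Finsupp.single i p) = ι p k L (ppow p k (b i)) := by
          rw [← ι_pow, mono_single_pow]
        rw [mono_add, h2]
        conv_lhs => rw [← b.linearCombination_repr (ppow p k (b i))]
        simp [Finsupp.linearCombination_apply, Finsupp.sum, map_sum, Finset.mul_sum, mono_add,
          mono_single]
      rw [h1]
      exact Submodule.sum_mem _ fun j _ => Submodule.smul_mem _ _
        (ih _ (hα ▸ degree_rewrite_lt hi j) _ rfl)
  rw [eq_top_iff]
  rintro a -
  obtain ⟨s, rfl⟩ := Ideal.Quotient.mk_surjective a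
  obtain ⟨f, rfl⟩ := (SymmetricAlgebra.equivMvPolynomial b).symm.surjective s
  change proj p k L _ ∈ _
  induction f using MvPolynomial.induction_on' with
  | add f g hf hg => rw [map_add, map_add]; exact add_mem hf hg
  | monomial β c => rw [proj_monomial]; exact Submodule.smul_mem _ _ (hm _ β rfl)

variable [CharP k p]

/-- The normal form kills the ideal of relations `x ^ p = x^[p]`. -/
theorem nfPoly_relation (f : MvPolynomial I k) (x : L) :
    nfPoly (p := p) b (f * (SymmetricAlgebra.equivMvPolynomial b (SymmetricAlgebra.ι k L x) ^ p -
      SymmetricAlgebra.equivMvPolynomial b (SymmetricAlgebra.ι k L (ppow p k x)))) = 0 := by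
  have h0 : ppow p k (0 : L) = 0 := by
    have := AbRestrictedLie.pMap_smul (p := p) (k := k) (0 : k) (0 : L)
    rwa [zero_smul, zero_pow (Fact.out : p.Prime).ne_zero, zero_smul] at this
  have hadd : ∀ x y : L, ppow p k (x + y) = ppow p k x + ppow p k y := AbRestrictedLie.pMap_add
  have hsmul : ∀ (c : k) (x : L), ppow p k (c • x) = c ^ p • ppow p k x :=
    AbRestrictedLie.pMap_smul
  -- Both `x ^ p` and `x^[p]` are `p`-semilinear, so `x` may be taken in the basis.
  have hx : x ∈ Submodule.span k (Set.range b) := b.span_eq ▸ Submodule.mem_top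
  induction hx using Submodule.span_induction with
  | zero => simp [h0, (Fact.out : p.Prime).ne_zero]
  | add x y _ _ hx hy =>
    rw [hadd, map_add, map_add, map_add, map_add, Cobar.add_pow_p k p, add_sub_add_comm, mul_add,
      map_add, hx, hy, add_zero]
  | smul c x _ hx =>
    rw [hsmul, map_smul, map_smul, map_smul, map_smul, smul_pow, ← smul_sub, mul_smul_comm,
      map_smul, hx, smul_zero]
  | mem x hx =>
    obtain ⟨i, rfl⟩ := hx
    induction f using MvPolynomial.induction_on' with
    | add f g hf hg => rw [add_mul, map_add, hf, hg, add_zero]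
    | monomial β c =>
      have hc : MvPolynomial.monomial β c = c • MvPolynomial.monomial β (1 : k) := by
        rw [MvPolynomial.smul_monomial, smul_eq_mul, mul_one]
      rw [hc, smul_mul_assoc, map_smul, mul_sub, map_sub, nfPoly_mul_linear,
        SymmetricAlgebra.equivMvPolynomial_ι_apply, MvPolynomial.X_pow_eq_monomial,
        MvPolynomial.monomial_mul, one_mul, nfPoly_monomial,
        nf_eq b (i := i) (by simp), add_tsub_cancel_right, sub_self, smul_zero]


theorem nfPoly_restrIdeal {a : SymmetricAlgebra k L} (ha : a ∈ restrIdeal p k L) :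
    nfPoly (p := p) b (SymmetricAlgebra.equivMvPolynomial b a) = 0 := by
  suffices h : ∀ f, nfPoly (p := p) b (f * SymmetricAlgebra.equivMvPolynomial b a) = 0 by
    simpa using h 1
  induction ha using Submodule.span_induction with
  | zero => simp
  | add x y _ _ hx hy => intro f; rw [map_add, mul_add, map_add, hx, hy, add_zero]
  | smul c x _ hx =>
    intro f
    rw [smul_eq_mul, map_mul (SymmetricAlgebra.equivMvPolynomial b), ← mul_assoc, hx]
  | mem x hx =>
    obtain ⟨x, rfl⟩ := hx
    intro f
    rw [map_sub, map_pow, nfPoly_relation]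

/-- The normal form map on `u(L)` attached to a basis of `L`. -/
def normalForm : RestrEnv p k L →ₗ[k] MvPolynomial I k :=
  ((restrIdeal p k L).restrictScalars k).liftQ
    (nfPoly (p := p) b ∘ₗ (SymmetricAlgebra.equivMvPolynomial b).toLinearMap)
    (fun _ ha => nfPoly_restrIdeal b ha)

theorem normalForm_mono {α : I →₀ ℕ} (h : ∀ i, α i < p) :
    normalForm b (mono (p := p) b α) = MvPolynomial.monomial α 1 := by
  rw [← one_smul k (mono b α), ← proj_monomial]
  change nfPoly (p := p) b (SymmetricAlgebra.equivMvPolynomial b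
    ((SymmetricAlgebra.equivMvPolynomial b).symm _)) = _
  rw [AlgEquiv.apply_symm_apply, nfPoly_monomial, nf_of_lt b h]

/-! ### Coefficients and primitive elements -/

/-- The functional on `u(L)` reading off the coefficient of the monomial with exponent `α`, with
respect to the basis of restricted monomials; it is zero if `α` is not restricted. -/
def coeffMono (α : I →₀ ℕ) : RestrEnv p k L →ₗ[k] k :=
  MvPolynomial.lcoeff k α ∘ₗ normalForm b

open Classical in
theorem coeffMono_mono (α : I →₀ ℕ) {β : I →₀ ℕ} (h : ∀ i, β i < p) :
    coeffMono (p := p) b α (mono b β) = if β = α then 1 else 0 := by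
  simp [coeffMono, normalForm_mono b h, MvPolynomial.coeff_monomial]

theorem single_one_lt (i j : I) : Finsupp.single i 1 j < p := by
  classical
  have := (Fact.out : p.Prime).two_le
  rw [Finsupp.single_apply]
  split_ifs <;> omega

theorem ι_injective : Function.Injective (ι p k L) := by
  let b := Module.Basis.ofVectorSpace k L
  have h : ∀ i, coeffMono b (Finsupp.single i 1) ∘ₗ ι p k L = b.coord i := by
    classical
    intro i
    refine b.ext fun j => ?_
    rw [LinearMap.comp_apply, ← mono_single, coeffMono_mono b _ (single_one_lt j),
      Module.Basis.coord_apply, Module.Basis.repr_self, Finsupp.single_apply]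
    simp [Finsupp.single_left_inj]
  intro x y hxy
  refine b.ext_elem fun i => ?_
  rw [← b.coord_apply, ← b.coord_apply, ← h, LinearMap.comp_apply, LinearMap.comp_apply, hxy]

/-- The comultiplication of a monomial is given by the binomial theorem. -/
theorem comul_mono [Fintype I] [DecidableEq I] (α : I →₀ ℕ) :
    Coalgebra.comul (R := k) (mono (p := p) b α) =
      ∑ β ∈ Fintype.piFinset fun i => Finset.range (α i + 1),
        (∏ i, ((α i).choose (β i) : k)) • (mono b (Finsupp.equivFunOnFinite.symm β) ⊗ₜ[k]
          mono b (α - Finsupp.equivFunOnFinite.symm β)) := by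
  have hp : ∀ α : I →₀ ℕ, mono (p := p) b α = ∏ i, ι p k L (b i) ^ α i := fun α =>
    Finsupp.prod_fintype _ _ fun _ => pow_zero _
  have ht : ∀ u v : I → RestrEnv p k L,
      (∏ i, u i) ⊗ₜ[k] (∏ i, v i) = ∏ i, u i ⊗ₜ[k] v i := fun u v => by
    induction (Finset.univ : Finset I) using Finset.induction_on with
    | empty => simp [Algebra.TensorProduct.one_def]
    | insert i s hi ih =>
      rw [Finset.prod_insert hi, Finset.prod_insert hi, Finset.prod_insert hi, ← ih,
        Algebra.TensorProduct.tmul_mul_tmul]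
  simp only [hp]
  rw [← Bialgebra.comulAlgHom_apply, map_prod]
  simp only [map_pow, Bialgebra.comulAlgHom_apply, comul_ι, add_pow]
  rw [Finset.prod_univ_sum]
  refine Finset.sum_congr rfl fun β _ => ?_
  rw [ht, ← Finset.prod_smul]
  refine Finset.prod_congr rfl fun i _ => ?_
  rw [Algebra.smul_def, map_natCast, mul_comm]
  simp [Algebra.TensorProduct.tmul_pow]

/-- A binomial formula for the coefficients of the comultiplication. -/
theorem coeffMono_comul [Fintype I] (β γ : I →₀ ℕ) (a : RestrEnv p k L) :
    TensorProduct.lid k k (TensorProduct.map (coeffMono b β) (coeffMono b γ)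
      (Coalgebra.comul (R := k) a)) =
    (∏ i, (((β + γ) i).choose (β i) : k)) * coeffMono b (β + γ) a := by
  classical
  have ha : a ∈ Submodule.span k (mono (p := p) b '' {α | ∀ i, α i < p}) :=
    span_mono (p := p) b ▸ Submodule.mem_top
  induction ha using Submodule.span_induction with
  | zero => simp
  | add x y _ _ hx hy => simp only [map_add, hx, hy, mul_add]
  | smul c x _ hx => simp only [map_smul, hx, smul_eq_mul]; ring
  | mem x hx =>
    obtain ⟨α, hα, rfl⟩ := hx
    change ∀ i, α i < p at hα
    rw [comul_mono, map_sum, map_sum, coeffMono_mono b _ hα]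
    have hs : ∀ δ ∈ Fintype.piFinset fun i => Finset.range (α i + 1),
        TensorProduct.lid k k (TensorProduct.map (coeffMono b β) (coeffMono b γ)
          ((∏ i, ((α i).choose (δ i) : k)) • (mono b (Finsupp.equivFunOnFinite.symm δ) ⊗ₜ[k]
          mono b (α - Finsupp.equivFunOnFinite.symm δ)))) =
        if δ = β then (if α = β + γ then ∏ i, (((β + γ) i).choose (β i) : k) else 0) else 0 := by
      intro δ hδ
      have hle : ∀ i, δ i ≤ α i := fun i => by
        have := Fintype.mem_piFinset.1 hδ i
        simp at this
        omega
      rw [map_smul, map_smul, TensorProduct.map_tmul, TensorProduct.lid_tmul, coeffMono_mono b,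
        coeffMono_mono b]
      · by_cases h1 : δ = β
        · subst h1
          have h2 : α - β = γ ↔ α = β + γ := by
            rw [tsub_eq_iff_eq_add_of_le fun i => hle i, add_comm]
          have h3 : Finsupp.equivFunOnFinite.symm ⇑β = β := Finsupp.ext fun _ => rfl
          by_cases h4 : α = β + γ
          · simp [h3, h4]
          · simp [h3, h4, h2]
        · have h3 : Finsupp.equivFunOnFinite.symm δ ≠ β := fun h => h1 (h ▸ rfl)
          simp [h1, h3]
      · intro i
        exact lt_of_le_of_lt (Nat.sub_le _ _) (hα i)
      · exact fun i => (hle i).trans_lt (hα i)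
    rw [Finset.sum_congr rfl hs, Finset.sum_ite_eq']
    by_cases h2 : α = β + γ
    · subst h2; simp
    · simp [h2]

/-- The primitive elements of `u(L)` are those of `L`. -/
theorem exists_ι_of_d1_eq_zero [FiniteDimensional k L] {a : RestrEnv p k L}
    (ha : Cobar.d1 k a = 0) : ∃ x, ι p k L x = a := by
  classical
  let b := Module.finBasis k L
  have hΔ : Coalgebra.comul (R := k) a = a ⊗ₜ 1 + 1 ⊗ₜ a := by
    rw [Cobar.d1_apply, sub_eq_zero] at ha
    exact ha.symm
  have hc := fun (β γ : Fin (Module.finrank k L) →₀ ℕ) =>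
    coeffMono_comul b β γ a
  have h0 : ∀ β, coeffMono b β (1 : RestrEnv p k L) = if 0 = β then 1 else 0 := fun β => by
    rw [← mono_zero b, coeffMono_mono b _ fun _ => (Fact.out : p.Prime).pos]
    congr
  simp only [hΔ, map_add, TensorProduct.map_tmul, TensorProduct.lid_tmul, h0] at hc
  have hcoeff : ∀ α : Fin (Module.finrank k L) →₀ ℕ, (∀ i, α i < p) →
      (∀ i, α ≠ Finsupp.single i 1) → coeffMono b α a = 0 := by
    intro α hα hne
    -- For `α ≠ 0` containing the index `i`, compare the coefficients at `b i ⊗ b ^ (α - eᵢ)` in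
    -- `Δ a` and in `a ⊗ 1 + 1 ⊗ a`: the binomial factor is `α i`, nonzero modulo `p`.
    by_cases hz : α = 0
    · subst hz
      simpa using hc 0 0
    · obtain ⟨i, hi⟩ := Finsupp.ne_iff.1 hz
      have hle : Finsupp.single i 1 ≤ α :=
        Finsupp.single_le_iff.2 (Nat.one_le_iff_ne_zero.2 hi)
      have hs : Finsupp.single i 1 + (α - Finsupp.single i 1) = α := add_tsub_cancel_of_le hle
      have := hc (Finsupp.single i 1) (α - Finsupp.single i 1)
      have h1 : (0 : Fin (Module.finrank k L) →₀ ℕ) ≠ Finsupp.single i 1 := by simp [eq_comm]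
      have h2 : 0 ≠ α - Finsupp.single i 1 := fun h =>
        hne i (by rw [← h, add_zero] at hs; exact hs.symm)
      rw [hs, if_neg h1, if_neg h2, smul_zero, zero_smul, add_zero, eq_comm, mul_eq_zero] at this
      refine this.resolve_left (Finset.prod_ne_zero_iff.2 fun j _ => ?_)
      rw [Ne, CharP.cast_eq_zero_iff k p]
      by_cases hj : j = i
      · subst hj
        rw [Finsupp.single_eq_same, Nat.choose_one_right]
        exact fun hd => absurd (Nat.le_of_dvd (Nat.pos_of_ne_zero hi) hd) (not_le.2 (hα j))
      · rw [Finsupp.single_eq_of_ne hj, Nat.choose_zero_right]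
        exact (Fact.out : p.Prime).one_lt.ne' ∘ Nat.dvd_one.1
  have hspan : a ∈ Submodule.span k (mono (p := p) b '' {α | ∀ i, α i < p}) :=
    span_mono (p := p) b ▸ Submodule.mem_top
  obtain ⟨l, hl, hla⟩ := (Finsupp.mem_span_image_iff_linearCombination k).1 hspan
  rw [Finsupp.mem_supported] at hl
  have hlc : ∀ α ∈ l.support, l α = coeffMono b α a := by
    intro α hα
    rw [← hla, Finsupp.linearCombination_apply, Finsupp.sum, map_sum, Finset.sum_eq_single α]
    · rw [map_smul, coeffMono_mono b _ (hl hα)]; simp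
    · intro β hβ hne
      rw [map_smul, coeffMono_mono b _ (hl hβ), if_neg hne, smul_zero]
    · exact fun h => absurd hα h
  change a ∈ LinearMap.range (ι p k L)
  rw [← hla, Finsupp.linearCombination_apply]
  refine Submodule.sum_mem _ fun α hα => Submodule.smul_mem _ _ ?_
  by_contra hr
  refine Finsupp.mem_support_iff.1 hα ((hlc α hα).trans (hcoeff α (hl hα) ?_))
  rintro i rfl
  exact hr ⟨b i, (mono_single b i).symm⟩

end NormalForm

end RestrEnv

/-! ### Tori -/

/-- A nonzero element of a torus has nonzero `p`-th power, as semisimple commutative algebras are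
reduced. -/
theorem IsTorus.eq_zero {p : ℕ} {k L : Type*} [Field k] [Fact p.Prime] [CharP k p]
    [AddCommGroup L] [Module k L] [AbRestrictedLie p k L]
    (hL : IsTorus p k L) {x : L} (hx : ppow p k x = 0) : x = 0 := by
  have := hL x
  have hn : (⟨RestrEnv.ι p k L x, Algebra.self_mem_adjoin_singleton k _⟩ :
      Algebra.adjoin k {RestrEnv.ι p k L x}) ^ p = 0 :=
    Subtype.ext (by simp [RestrEnv.ι_pow, hx])
  have h0 := congrArg Subtype.val (eq_zero_of_pow_eq_zero hn)
  exact RestrEnv.ι_injective (h0.trans (map_zero _).symm)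

/-- Over a perfect field every element of a finite-dimensional torus is a `p`-th power: the `p`-map
is injective and `p`-semilinear, so its image is a subspace of full dimension. -/
theorem IsTorus.ppow_surjective {p : ℕ} {k L : Type*} [Field k] [Fact p.Prime]
    [CharP k p] [PerfectField k] [AddCommGroup L] [Module k L]
    [FiniteDimensional k L] [AbRestrictedLie p k L] (hL : IsTorus p k L) :
    Function.Surjective (ppow p k : L → L) := by
  have hsum : ∀ c : Fin (Module.finrank k L) → k, ∀ v : Fin (Module.finrank k L) → L,
      ppow p k (∑ i, c i • v i) = ∑ i, c i ^ p • ppow p k (v i) := fun c v => by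
    have h := map_sum (AddMonoidHom.mk' (ppow p k : L → L) AbRestrictedLie.pMap_add)
      (fun i => c i • v i) Finset.univ
    exact h.trans (Finset.sum_congr rfl fun i _ => AbRestrictedLie.pMap_smul _ _)
  have hroot : ∀ c : Fin (Module.finrank k L) → k, ∃ d : Fin (Module.finrank k L) → k,
      c = fun i => d i ^ p := fun c => by
    have := PerfectField.toPerfectRing (K := k) p
    choose d hd using fun i => (PerfectRing.bijective_frobenius (R := k) (p := p)).2 (c i)
    exact ⟨d, funext fun i => (hd i).symm⟩
  let b := Module.finBasis k L
  have hli : LinearIndependent k fun i => ppow p k (b i) := by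
    rw [Fintype.linearIndependent_iff]
    intro c hc i
    obtain ⟨d, rfl⟩ := hroot c
    have h0 := hL.eq_zero ((hsum d b).trans hc)
    change d i ^ p = 0
    rw [Fintype.linearIndependent_iff.1 b.linearIndependent d h0 i,
      zero_pow (Fact.out : p.Prime).ne_zero]
  have hspan := hli.span_eq_top_of_card_eq_finrank' (by simp)
  intro y
  obtain ⟨c, rfl⟩ := (Submodule.mem_span_range_iff_exists_fun k).1
    (hspan ▸ Submodule.mem_top : y ∈ Submodule.span k (Set.range fun i => ppow p k (b i)))
  obtain ⟨d, rfl⟩ := hroot c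
  exact ⟨_, hsum d b⟩

/-! ### Powers of the derivation `ρ_z` -/

namespace HopfType

variable {p : ℕ} {k g h : Type*} [Field k] [AddCommGroup g] [Module k g]
    [AbRestrictedLie p k g] [AddCommGroup h] [Module k h] [AbRestrictedLie p k h]
    (T : HopfType p k g h)

theorem ppow_z : ppow p k T.z = -(T.lam • T.z) := eq_neg_of_add_eq_zero_left T.z_rel

theorem ρ_z_pow : T.ρ T.z ^ p = -(T.lam • T.ρ T.z) := by
  rw [← T.ρ_ppow, ppow_z, map_neg, map_smul]

variable [Fact p.Prime] [CharP k p]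

theorem δ_mul (a b : RestrEnv p k h) : T.δ (a * b) = a * T.δ b + b * T.δ a :=
  (RestrEnv.deriv (T.ρ T.z) (T.ρ_apply_ppow T.z)).leibniz a b

theorem δ_pow_p (a : RestrEnv p k h) : T.δ (a ^ p) = 0 := by
  have h1 : T.δ (a ^ p) = p • a ^ (p - 1) • T.δ a :=
    (RestrEnv.deriv (T.ρ T.z) (T.ρ_apply_ppow T.z)).leibniz_pow a p
  rw [h1, ← Nat.cast_smul_eq_nsmul k, CharP.cast_eq_zero, zero_smul]

/-- Since `δ ⊗ 1` and `1 ⊗ δ` commute, the `p`-th power of the diagonal action is the diagonal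
action of `δ ^ p`. -/
theorem diag2_pow_p {A : Type*} [CommRing A] [Bialgebra k A] (δ : A →ₗ[k] A) :
    Cobar.diag2 δ ^ p = Cobar.diag2 (δ ^ p) := by
  have hc : Commute (δ.rTensor A) (δ.lTensor A) := by
    rw [Commute, SemiconjBy, Module.End.mul_eq_comp, Module.End.mul_eq_comp,
      LinearMap.rTensor_comp_lTensor, LinearMap.lTensor_comp_rTensor]
  have hp : (p : Module.End k (A ⊗[k] A)) = 0 := by
    rw [← map_natCast (algebraMap k (Module.End k (A ⊗[k] A))), CharP.cast_eq_zero, map_zero]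
  rw [Cobar.diag2, Cobar.diag2]
  rcases subsingleton_or_nontrivial (Module.End k (A ⊗[k] A)) with hs | hs
  · exact Subsingleton.elim _ _
  have : CharP (Module.End k (A ⊗[k] A)) p :=
    charP_of_injective_algebraMap (algebraMap k _).injective p
  rw [add_pow_char_of_commute _ hc, LinearMap.rTensor_pow, LinearMap.lTensor_pow]

/-- The multiplication `A ⊗ A → A` intertwines the diagonal action with `δ`. -/
theorem δ_comp_mul' : T.δ ∘ₗ LinearMap.mul' k (RestrEnv p k h) =
    LinearMap.mul' k (RestrEnv p k h) ∘ₗ Cobar.diag2 T.δ := by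
  ext a b
  simp [Cobar.diag2, δ_mul]
  ring

/-- The relation `z ^ p = -λ z` holds for the action on `u(𝔥)`. -/
theorem δ_pow : T.δ ^ p = -(T.lam • T.δ) := by
  have hp := (Fact.out : p.Prime).ne_zero
  -- By the intertwining property and the formula for the diagonal action, `δ ^ p` is a derivation.
  have hmul : ∀ a b, (T.δ ^ p) (a * b) = (T.δ ^ p) a * b + a * (T.δ ^ p) b := by
    intro a b
    have := LinearMap.congr_fun (Module.End.commute_pow_left_of_commute T.δ_comp_mul' p) (a ⊗ₜ b)
    rw [diag2_pow_p] at this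
    simpa [Cobar.diag2] using this
  have hc : T.δ ∘ₗ RestrEnv.ι p k h = RestrEnv.ι p k h ∘ₗ T.ρ T.z := LinearMap.ext T.δ_ι
  apply LinearMap.ext
  intro a
  induction a using RestrEnv.induct with
  | h0 c =>
    have h1 : T.δ (algebraMap k _ c) = 0 := by
      rw [Algebra.algebraMap_eq_smul_one, map_smul, T.δ_compat.map_one, smul_zero]
    obtain ⟨n, hn⟩ := Nat.exists_eq_succ_of_ne_zero hp
    simp [hn, pow_succ, h1]
  | h1 x =>
    have := LinearMap.congr_fun (Module.End.commute_pow_left_of_commute hc p) x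
    simp only [LinearMap.comp_apply, ρ_z_pow] at this
    simp [this, δ_ι]
  | hm a b ha hb =>
    rw [hmul, ha, hb]
    simp [δ_mul, mul_comm b]
  | ha a b ha hb => rw [map_add, map_add, ha, hb]

/-- Elements of `A ⊗ A` have additive `p`-th powers, so it suffices that `δ` kills `p`-th powers
in `A`. -/
theorem diag2_pow_char (x : RestrEnv p k h ⊗[k] RestrEnv p k h) :
    Cobar.diag2 T.δ (x ^ p) = 0 := by
  induction x with
  | zero => rw [zero_pow (Fact.out : p.Prime).ne_zero, map_zero]
  | add a b ha hb => rw [Cobar.add_pow_p k p, map_add, ha, hb, add_zero]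
  | tmul a b => simp [Cobar.diag2, Algebra.TensorProduct.tmul_pow, δ_pow_p]

/-- The image of `Φ_z` on `A ⊗ A` is killed by the diagonal action of `z`. -/
theorem diag2_phi2 (x : RestrEnv p k h ⊗[k] RestrEnv p k h) :
    Cobar.diag2 T.δ (T.phi2 x) = 0 := by
  have h1 : Cobar.diag2 T.δ ^ p = -(T.lam • Cobar.diag2 T.δ) := by
    rw [diag2_pow_p, δ_pow]
    simp [Cobar.diag2, LinearMap.rTensor_neg, LinearMap.lTensor_neg]
    abel
  have h2 : Cobar.diag2 T.δ ((Cobar.diag2 T.δ ^ (p - 1)) x) = (Cobar.diag2 T.δ ^ p) x := by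
    rw [← Module.End.mul_apply, mul_pow_sub_one (Fact.out : p.Prime).ne_zero]
  rw [phi2, Cobar.zOp, map_add, map_add, diag2_pow_char, h2, h1]
  simp

/-! ### The projection `q` -/

theorem δ_eq_zero_of_ρ_eq_zero (h0 : T.ρ T.z = 0) : T.δ = 0 := by
  apply LinearMap.ext
  intro a
  induction a using RestrEnv.induct with
  | h0 c => rw [Algebra.algebraMap_eq_smul_one, map_smul, T.δ_compat.map_one, smul_zero]; rfl
  | h1 x => rw [δ_ι, h0]; simp
  | hm a b ha hb => rw [δ_mul, ha, hb]; simp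
  | ha a b ha hb => rw [map_add, map_add, ha, hb]

/-- If `Φ_z(χ) = d¹(a)`, then `ρ_z(a)` is primitive, hence an element of `𝔥`. -/
theorem exists_ι_eq_δ [FiniteDimensional k h] {χ : RestrEnv p k h ⊗[k] RestrEnv p k h} {a : RestrEnv p k h}
    (ha : T.phi2 χ = Cobar.d1 k a) : ∃ y, RestrEnv.ι p k h y = T.δ a := by
  refine RestrEnv.exists_ι_of_d1_eq_zero ?_
  have h1 : Coalgebra.comul (R := k) (T.δ a) = Cobar.diag2 T.δ (Coalgebra.comul (R := k) a) :=
    LinearMap.congr_fun T.δ_compat.comul a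
  have h2 := T.diag2_phi2 χ
  rw [ha, Cobar.d1_apply] at h2
  rw [Cobar.d1_apply, ← h2]
  simp [h1, Cobar.diag2, T.δ_compat.map_one]
  abel

theorem d1_ι (x : h) : Cobar.d1 k (RestrEnv.ι p k h x) = 0 := by
  rw [Cobar.d1_apply]
  simp [RestrEnv.comul_ι]

/-- If `𝔥` or `𝔤` is a torus, all `z`-characteristic classes are admissible. -/
theorem zChar_subset_adm [FiniteDimensional k h] [PerfectField k] (ht : IsTorus p k h ∨ IsTorus p k g) :
    T.zChar ⊆ T.adm := by
  intro ξ hξ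
  obtain ⟨χ, rfl⟩ := Submodule.Quotient.mk_surjective _ ξ
  obtain ⟨a, ha, hd⟩ := (T.mem_zChar_iff χ).1 hξ
  rcases ht with ht | ht
  · have h0 : T.ρ T.z = 0 := by
      ext x
      obtain ⟨y, rfl⟩ := ht.ppow_surjective x
      exact T.ρ_apply_ppow T.z y
    exact ⟨χ, rfl, a, ha, hd.symm, by rw [T.δ_eq_zero_of_ρ_eq_zero h0]; rfl⟩
  · have hlam : T.lam ≠ 0 := fun h0 =>
      T.z_ne_zero (ht.eq_zero (by rw [ppow_z, h0, zero_smul, neg_zero]))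
    obtain ⟨y, hy⟩ := T.exists_ι_eq_δ hd.symm
    have hc : T.δ ∘ₗ RestrEnv.ι p k h = RestrEnv.ι p k h ∘ₗ T.ρ T.z := LinearMap.ext T.δ_ι
    have hp : p - 1 = p - 2 + 1 := by have := (Fact.out : p.Prime).two_le; omega
    -- As `δ ^ p = -λ δ` with `λ ≠ 0`, the element `y` of `𝔥 ∩ δ(A)` lies in `ρ_z(𝔥)`.
    have hyρ : T.lam • y = -T.ρ T.z ((T.ρ T.z ^ (p - 2)) y) := by
      apply RestrEnv.ι_injective (p := p) (k := k)
      have h1 := LinearMap.congr_fun (Module.End.commute_pow_left_of_commute hc (p - 1)) y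
      have h2 : (T.δ ^ (p - 1)) (T.δ a) = -(T.lam • T.δ a) := by
        rw [← Module.End.mul_apply, pow_sub_one_mul (Fact.out : p.Prime).ne_zero, δ_pow]; rfl
      rw [LinearMap.comp_apply, LinearMap.comp_apply, hy, h2, ← hy] at h1
      rw [← Module.End.mul_apply, ← pow_succ', ← hp, map_neg, ← h1, neg_neg, map_smul]
    refine ⟨χ, rfl, a + RestrEnv.ι p k h (T.lam⁻¹ • (T.ρ T.z ^ (p - 2)) y),
      add_mem ha (RestrEnv.counit_ι _), ?_, ?_⟩
    · rw [map_add, d1_ι, add_zero, hd]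
    · rw [map_add, δ_ι, ← hy, map_smul, ← neg_eq_iff_eq_neg.2 hyρ, smul_neg, smul_smul,
        inv_mul_cancel₀ hlam, one_smul, map_neg, add_neg_cancel]

/-- `q` is injective: two pairs with cohomologous `χ` differ, up to equivalence, by a primitive
element killed by `ρ_z`, which by hypothesis has the form `Φ_z(y)` with `y ∈ 𝔥`. -/
theorem qBA_injective [FiniteDimensional k h]
    (hker : {x : h | T.ρ T.z x = 0} = Set.range T.phiLie) :
    Function.Injective T.qBA := by
  intro c c' hcc
  induction c using Quotient.inductionOn with | h x
  induction c' using Quotient.inductionOn with | h y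
  obtain ⟨a, ha, hd⟩ := Cobar.cls_eq.1 (show Cobar.cls x.1.2 = Cobar.cls y.1.2 from hcc)
  obtain ⟨⟨Θ, χ⟩, h1, h2, h3⟩ := x
  obtain ⟨⟨Θ', χ'⟩, h1', h2', h3'⟩ := y
  dsimp only at h1 h2 h3 h1' h2' h3' hd
  have hd1 : Cobar.d1 k (Θ - Θ' - T.phi1 a) = 0 := by
    have h4 : Cobar.d1 k (T.phi1 a) = T.phi2 (χ - χ') := by
      rw [← hd]; exact Cobar.zOp_d1 T.δ_compat a
    rw [map_sub, map_sub, ← h3, ← h3', h4, phi2, Cobar.zOp_sub, sub_self]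
  obtain ⟨x, hx⟩ := RestrEnv.exists_ι_of_d1_eq_zero hd1
  have hδΦ : T.δ (T.phi1 a) = 0 := by
    have h5 : T.δ ((T.δ ^ (p - 1)) a) = (T.δ ^ p) a := by
      rw [← Module.End.mul_apply, mul_pow_sub_one (Fact.out : p.Prime).ne_zero]
    rw [phi1, Cobar.zOp, map_add, map_add, δ_pow_p, h5, δ_pow]
    simp
  have hρ : T.ρ T.z x = 0 := by
    apply RestrEnv.ι_injective (p := p) (k := k)
    rw [← δ_ι, hx, map_sub, map_sub, h2, h2', hδΦ]; simp
  obtain ⟨y, rfl⟩ : x ∈ Set.range T.phiLie := hker ▸ hρ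
  refine Quotient.sound ⟨a + RestrEnv.ι p k h y, add_mem ha (RestrEnv.counit_ι _), ?_, ?_⟩
  · change _ = Cobar.zOp p T.lam T.δ _
    rw [Cobar.zOp_add]
    change _ = T.phi1 a + T.phi1 (RestrEnv.ι p k h y)
    rw [phi1_ι, hx]
    simp
  · rw [map_add, d1_ι, add_zero, hd]

/-- Every nonzero admissible class lifts to `𝓗²(T)`. -/
theorem mem_range_qBA {ξ : Cobar.H2 k (RestrEnv p k h)} (hξ : ξ ∈ T.adm) (h0 : ξ ≠ 0) :
    ∃ c : T.HT, T.qBA c.1 = ξ := by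
  obtain ⟨χ, rfl, a, ha, h1, h2⟩ := hξ
  refine ⟨⟨Quotient.mk T.E2Setoid ⟨(a, χ), ha, h2, h1⟩, ?_⟩, rfl⟩
  rintro ⟨y, hy, hyc⟩
  have h3 : Cobar.cls y.1.2 = Cobar.cls χ := congrArg T.qBA hyc
  refine h0 (h3 ▸ Cobar.cls_eq.2 ?_)
  simpa using hy

end HopfType

/-! ### Orbits -/

/-- An equivariant bijection induces a bijection on orbits. -/
theorem orbits_bijective {G X Y : Type*} [Group G] [MulAction G X] [MulAction G Y] {f : X → Y}
    (hf : Function.Bijective f) (hs : ∀ (σ : G) x, f (σ • x) = σ • f x)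
    {F : MulAction.orbitRel.Quotient G X → MulAction.orbitRel.Quotient G Y}
    (hF : ∀ x, F (Quotient.mk _ x) = Quotient.mk _ (f x)) : Function.Bijective F := by
  constructor
  · intro c c' hcc
    induction c using Quotient.inductionOn with | h x
    induction c' using Quotient.inductionOn with | h y
    rw [hF, hF] at hcc
    obtain ⟨σ, hσ⟩ := Quotient.exact hcc
    exact Quotient.sound ⟨σ, hf.1 ((hs σ y).trans hσ)⟩
  · intro c
    induction c using Quotient.inductionOn with | h y
    obtain ⟨x, rfl⟩ := hf.2 y
    exact ⟨Quotient.mk _ x, hF x⟩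

theorem proposition5p5 {p : ℕ} [Fact p.Prime] {k g h : Type*} [Field k] [CharP k p]
    [PerfectField k] [AddCommGroup g] [Module k g] [AbRestrictedLie p k g]
    [AddCommGroup h] [Module k h] [FiniteDimensional k h] [AbRestrictedLie p k h]
    (T : HopfType p k g h)
    (hker : {x : h | T.ρ T.z x = 0} = Set.range T.phiLie) :
    Function.Bijective T.qOrbits ∧
      (IsTorus p k h ∨ IsTorus p k g → Function.Bijective T.qZOrbits) := by
  have hinj := T.qBA_injective hker
  refine ⟨orbits_bijective (f := T.q) ⟨?_, ?_⟩ T.q_smul fun _ => rfl, fun ht =>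
    orbits_bijective (f := T.qZ) ⟨?_, ?_⟩ T.qZ_smul fun _ => rfl⟩
  · exact fun c c' hcc => Subtype.ext (hinj (congrArg Subtype.val hcc))
  · rintro ⟨ξ, hξ, h0⟩
    obtain ⟨c, hc⟩ := T.mem_range_qBA hξ h0
    exact ⟨c, Subtype.ext hc⟩
  · exact fun c c' hcc => Subtype.ext (hinj (congrArg Subtype.val hcc))
  · rintro ⟨ξ, hξ, h0⟩
    obtain ⟨c, hc⟩ := T.mem_range_qBA (T.zChar_subset_adm ht hξ) h0
    exact ⟨c, Subtype.ext hc⟩
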